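/- \textbf{Conventions.} $\mathsf{RCA}_0$ is the usual base theory of reverse mathematics in the two-sorted language of second order arithmetic: the basic axioms about $0,1,+,\cdot,<$, induction for $\Sigma^0_1$-formulas, and comprehension for $\Delta^0_1$-properties, with parameters allowed in both schemes. A statement holds over $\mathsf{RCA}_0$ if it is true in every (possibly nonstandard) model $(M,\mathcal S)$ of $\mathsf{RCA}_0$, where number quantifiers range over $M$ and set quantifiers over $\mathcal S\subseteq\mathcal P(M)$ (by the completeness theorem, this is provability in $\mathsf{RCA}_0$). The following notions are understood inside such a model, and $\mathbb N$ denotes its domain of numbers. Let $[\mathbb N]^\omega$ be the collection of infinite (i.e., unbounded) sets $X\subseteq\mathbb N$. For $X\in[\mathbb N]^\omega$ with least element $x_0$ we put $X^-=X\setminus\{x_0\}$. A function $F:[\mathbb N]^\omega\to Q$ into a quasi order $Q$ is called bad if there is no $X\in[\mathbb N]^\omega$ with $F(X)\leq_Q F(X^-)$. It is a $\Delta^0_2$-function if the relation $F(X)=q$ is defined by a $\Sigma^0_2$-formula, possibly with number and set parameters. We say that $Q$ is $\Delta^0_2\text{-}\mathsf{BQO}$ if there is no bad $\Delta^0_2$-function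 $F:[\mathbb N]^\omega\to Q$. Let $\mathbf 3$ be the discrete order on $\{0,1,2\}$ (that is, $p\leq q$ only for $p=q$). A well order $\Omega$ is a linear order on a subset of $\mathbb N$, given by sets, that admits no infinite descending sequence $f:\mathbb N\to\Omega$. The product $\Omega\times\Omega$ consists of (codes of) pairs, with $\langle\alpha,\beta\rangle\leq\langle\alpha',\beta'\rangle$ if and only if $\alpha\leq\alpha'$ and $\beta\leq\beta'$. \textbf{Corollary.} Over $\mathsf{RCA}_0$: if $\mathbf 3$ is $\Delta^0_2\text{-}\mathsf{BQO}$, then so is $\Omega\times\Omega$ for every well order $\Omega$. -/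

import Mathlib

universe u

/-- A structure for the two-sorted language `L₂` of second order arithmetic: numbers, with
`0, 1, +, ·, <`, and a nonempty collection of subsets of the number domain. The number domain may be
nonstandard and the collection of sets need not be closed under anything. -/
structure L2Structure : Type (u + 1) where
  Num : Type u
  zero : Num
  one : Num
  add : Num → Num → Num
  mul : Num → Num → Num
  lt : Num → Num → Prop
  sets : Set (Set Num)
  sets_nonempty : sets.Nonempty

namespace L2Structure

/-- The second sort: the sets of the structure. -/
abbrev Sets (M : L2Structure.{u}) : Type u := ↥M.sets

/-! ### Syntax: terms and formulas of `L₂` with parameters from a structure -/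

/-- Number terms, with number parameters from `M`. -/
inductive Term (M : L2Structure.{u}) : Type u
  | var : ℕ → Term M
  | param : M.Num → Term M
  | zero : Term M
  | one : Term M
  | add : Term M → Term M → Term M
  | mul : Term M → Term M → Term M

/-- The number variables that occur in a term. -/
def Term.vars {M : L2Structure.{u}} : Term M → Set ℕ
  | .var i => {i}
  | .param _ => ∅
  | .zero => ∅
  | .one => ∅
  | .add s t => s.vars ∪ t.vars
  | .mul s t => s.vars ∪ t.vars

/-- Formulas of `L₂`, with number and set parameters from `M`. Number variables and set variables
are both indexed by `ℕ`. (Equality between sets is not primitive.) -/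
inductive Formula (M : L2Structure.{u}) : Type u
  | eq : Term M → Term M → Formula M
  | lt : Term M → Term M → Formula M
  | memVar : Term M → ℕ → Formula M
  | memParam : Term M → M.Sets → Formula M
  | neg : Formula M → Formula M
  | and : Formula M → Formula M → Formula M
  | or : Formula M → Formula M → Formula M
  | imp : Formula M → Formula M → Formula M
  | allNum : ℕ → Formula M → Formula M
  | exNum : ℕ → Formula M → Formula M
  | allSet : ℕ → Formula M → Formula M
  | exSet : ℕ → Formula M → Formula M

/-- Bounded (that is, `Δ⁰₀`) formulas: there are no set quantifiers, and all number quantifiers are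
of the form `∀ n < t` or `∃ n < t` for a term `t` in which `n` does not occur. -/
inductive Formula.IsBounded {M : L2Structure.{u}} : Formula M → Prop
  | eq (s t : Term M) : IsBounded (.eq s t)
  | lt (s t : Term M) : IsBounded (.lt s t)
  | memVar (t : Term M) (k : ℕ) : IsBounded (.memVar t k)
  | memParam (t : Term M) (X : M.Sets) : IsBounded (.memParam t X)
  | neg {φ : Formula M} : IsBounded φ → IsBounded (.neg φ)
  | and {φ ψ : Formula M} : IsBounded φ → IsBounded ψ → IsBounded (.and φ ψ)
  | or {φ ψ : Formula M} : IsBounded φ → IsBounded ψ → IsBounded (.or φ ψ)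
  | imp {φ ψ : Formula M} : IsBounded φ → IsBounded ψ → IsBounded (.imp φ ψ)
  | ball {n : ℕ} {t : Term M} {φ : Formula M} : n ∉ t.vars → IsBounded φ →
      IsBounded (.allNum n (.imp (.lt (.var n) t) φ))
  | bex {n : ℕ} {t : Term M} {φ : Formula M} : n ∉ t.vars → IsBounded φ →
      IsBounded (.exNum n (.and (.lt (.var n) t) φ))

/-- `Σ⁰₁`-formulas: `∃ n θ` with `θ` bounded. -/
def Formula.IsSigma01 {M : L2Structure.{u}} (φ : Formula M) : Prop :=
  ∃ (n : ℕ) (θ : Formula M), θ.IsBounded ∧ φ = .exNum n θ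

/-- `Π⁰₁`-formulas: `∀ n θ` with `θ` bounded. -/
def Formula.IsPi01 {M : L2Structure.{u}} (φ : Formula M) : Prop :=
  ∃ (n : ℕ) (θ : Formula M), θ.IsBounded ∧ φ = .allNum n θ

/-- `Σ⁰₂`-formulas: `∃ m ∀ n θ` with `θ` bounded. -/
def Formula.IsSigma02 {M : L2Structure.{u}} (φ : Formula M) : Prop :=
  ∃ (m n : ℕ) (θ : Formula M), θ.IsBounded ∧ φ = .exNum m (.allNum n θ)

/-! ### Semantics -/

/-- The value of a term under an assignment to the number variables. -/
def Term.val {M : L2Structure.{u}} (v : ℕ → M.Num) : Term M → M.Num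
  | .var i => v i
  | .param a => a
  | .zero => M.zero
  | .one => M.one
  | .add s t => M.add (s.val v) (t.val v)
  | .mul s t => M.mul (s.val v) (t.val v)

/-- Satisfaction of a formula in `M` under assignments `v` to the number variables and `W` to the
set variables. -/
def Formula.Sat {M : L2Structure.{u}} : Formula M → (ℕ → M.Num) → (ℕ → M.Sets) → Prop
  | .eq s t, v, _ => s.val v = t.val v
  | .lt s t, v, _ => M.lt (s.val v) (t.val v)
  | .memVar t k, v, W => t.val v ∈ (W k).1
  | .memParam t X, v, _ => t.val v ∈ X.1
  | .neg φ, v, W => ¬ φ.Sat v W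
  | .and φ ψ, v, W => φ.Sat v W ∧ ψ.Sat v W
  | .or φ ψ, v, W => φ.Sat v W ∨ ψ.Sat v W
  | .imp φ ψ, v, W => φ.Sat v W → ψ.Sat v W
  | .allNum i φ, v, W => ∀ a : M.Num, φ.Sat (Function.update v i a) W
  | .exNum i φ, v, W => ∃ a : M.Num, φ.Sat (Function.update v i a) W
  | .allSet k φ, v, W => ∀ X : M.Sets, φ.Sat v (Function.update W k X)
  | .exSet k φ, v, W => ∃ X : M.Sets, φ.Sat v (Function.update W k X)

/-- `M` is a model of `RCA₀`: the basic axioms about the number domain, induction for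
`Σ⁰₁`-formulas and comprehension for `Δ⁰₁`-properties. Parameters are allowed in both schemes. -/
structure IsModelRCA0 (M : L2Structure.{u}) : Prop where
  succ_ne_zero : ∀ n, M.add n M.one ≠ M.zero
  succ_inj : ∀ m n, M.add m M.one = M.add n M.one → m = n
  add_zero : ∀ m, M.add m M.zero = m
  add_succ : ∀ m n, M.add m (M.add n M.one) = M.add (M.add m n) M.one
  mul_zero : ∀ m, M.mul m M.zero = M.zero
  mul_succ : ∀ m n, M.mul m (M.add n M.one) = M.add (M.mul m n) m
  not_lt_zero : ∀ m, ¬ M.lt m M.zero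
  lt_succ_iff : ∀ m n, M.lt m (M.add n M.one) ↔ M.lt m n ∨ m = n
  sigma01_induction : ∀ φ : Formula M, φ.IsSigma01 →
    ∀ (v : ℕ → M.Num) (W : ℕ → M.Sets) (i : ℕ),
      φ.Sat (Function.update v i M.zero) W →
      (∀ n, φ.Sat (Function.update v i n) W →
        φ.Sat (Function.update v i (M.add n M.one)) W) →
      ∀ n, φ.Sat (Function.update v i n) W
  delta01_comprehension : ∀ φ ψ : Formula M, φ.IsSigma01 → ψ.IsPi01 →
    ∀ (v : ℕ → M.Num) (W : ℕ → M.Sets) (i : ℕ),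
      (∀ n, φ.Sat (Function.update v i n) W ↔ ψ.Sat (Function.update v i n) W) →
      ∃ X : M.Sets, ∀ n, n ∈ X.1 ↔ φ.Sat (Function.update v i n) W

/-! ### Notions internal to a structure

All quantifiers below range over the numbers and the sets of the structure. -/

/-- The code `(a + b)² + a` of the pair `⟨a, b⟩`. -/
def pair (M : L2Structure.{u}) (a b : M.Num) : M.Num :=
  M.add (M.mul (M.add a b) (M.add a b)) a

/-- `X ∈ [ℕ]^ω`: the set `X` is unbounded. -/
def IsInfinite (M : L2Structure.{u}) (X : M.Sets) : Prop :=
  ∀ n, ∃ m, M.lt n m ∧ m ∈ X.1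

/-- `Y = X⁻`: the set `Y` arises from `X` by removing the minimal element of `X`. -/
def IsTail (M : L2Structure.{u}) (X Y : M.Sets) : Prop :=
  ∃ x, x ∈ X.1 ∧ (∀ n, n ∈ X.1 → ¬ M.lt n x) ∧ ∀ n, n ∈ Y.1 ↔ n ∈ X.1 ∧ n ≠ x

/-- `f` codes a total function from the numbers to the numbers, by its graph. -/
def IsFun (M : L2Structure.{u}) (f : M.Sets) : Prop :=
  ∀ n, ∃! a, M.pair n a ∈ f.1

/-- An order on (codes in) the number domain: the underlying collection and the order relation.
Below this is used for orders that are elementarily definable from sets of the structure. -/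
structure Order (M : L2Structure.{u}) where
  carrier : M.Num → Prop
  le : M.Num → M.Num → Prop

/-- The order with underlying set `D` and order relation coded by the set `R` of pairs. -/
def codedOrder (M : L2Structure.{u}) (D R : M.Sets) : M.Order where
  carrier a := a ∈ D.1
  le a b := a ∈ D.1 ∧ b ∈ D.1 ∧ M.pair a b ∈ R.1

/-- The discrete order `𝟑` with underlying set `{0, 1, 2}`. -/
def three (M : L2Structure.{u}) : M.Order where
  carrier a := a = M.zero ∨ a = M.one ∨ a = M.add M.one M.one
  le a b := (a = M.zero ∨ a = M.one ∨ a = M.add M.one M.one) ∧ a = b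

/-- The product `P × Q`, with the componentwise order on codes of pairs. -/
def prod {M : L2Structure.{u}} (P Q : M.Order) : M.Order where
  carrier c := ∃ p q, P.carrier p ∧ Q.carrier q ∧ c = M.pair p q
  le c c' := ∃ p q p' q', c = M.pair p q ∧ c' = M.pair p' q' ∧ P.le p p' ∧ Q.le q q'

/-- `(D, R)` is a well order in `M`: a linear order such that `M` contains no infinite
descending sequence. -/
structure IsWellOrder (M : L2Structure.{u}) (D R : M.Sets) : Prop where
  refl : ∀ a, a ∈ D.1 → M.pair a a ∈ R.1
  antisymm : ∀ a b, a ∈ D.1 → b ∈ D.1 → M.pair a b ∈ R.1 → M.pair b a ∈ R.1 → a = b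
  trans : ∀ a b c, a ∈ D.1 → b ∈ D.1 → c ∈ D.1 →
    M.pair a b ∈ R.1 → M.pair b c ∈ R.1 → M.pair a c ∈ R.1
  total : ∀ a b, a ∈ D.1 → b ∈ D.1 → M.pair a b ∈ R.1 ∨ M.pair b a ∈ R.1
  no_descent : ¬ ∃ f : M.Sets, M.IsFun f ∧
    ∀ n a b, M.pair n a ∈ f.1 → M.pair (M.add n M.one) b ∈ f.1 →
      a ∈ D.1 ∧ b ∈ D.1 ∧ M.pair b a ∈ R.1 ∧ b ≠ a

/-- The relation between `X` and `q` that is defined by `φ`, where the set variable with index `0`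
stands for `X`, the number variable with index `0` stands for `q`, and the remaining variables are
assigned values by `v` and `W`. -/
def DefRel {M : L2Structure.{u}} (φ : Formula M) (v : ℕ → M.Num) (W : ℕ → M.Sets)
    (X : M.Sets) (q : M.Num) : Prop :=
  φ.Sat (Function.update v 0 q) (Function.update W 0 X)

/-- The formula `φ` defines the relation `F(X) = q` for a function `F : [ℕ]^ω → Q`. -/
def DefinesFun {M : L2Structure.{u}} (φ : Formula M) (v : ℕ → M.Num) (W : ℕ → M.Sets)
    (Q : M.Order) : Prop :=
  ∀ X : M.Sets, M.IsInfinite X → ∃ q, Q.carrier q ∧ ∀ p, DefRel φ v W X p ↔ p = q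

/-- The function defined by `φ` is bad: there is no `X ∈ [ℕ]^ω` with `F(X) ≤ F(X⁻)`. -/
def IsBad {M : L2Structure.{u}} (φ : Formula M) (v : ℕ → M.Num) (W : ℕ → M.Sets)
    (Q : M.Order) : Prop :=
  ¬ ∃ X Y : M.Sets, M.IsInfinite X ∧ M.IsTail X Y ∧
    ∃ p q, DefRel φ v W X p ∧ DefRel φ v W Y q ∧ Q.le p q

/-- `Q` is `Δ⁰₂`-BQO in `M`: there is no bad function `F : [ℕ]^ω → Q` such that the relation
`F(X) = q` is defined by a `Σ⁰₂`-formula with parameters. -/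
def IsDelta02BQO {M : L2Structure.{u}} (Q : M.Order) : Prop :=
  ∀ φ : Formula M, φ.IsSigma02 → ∀ (v : ℕ → M.Num) (W : ℕ → M.Sets),
    DefinesFun φ v W Q → ¬ IsBad φ v W Q

end L2Structure

/-! # Products of well orders and the better quasi order with three elements -/

namespace L2Structure

variable {M : L2Structure.{u}}

/-! Let `F` be a bad function into `Ω × Ω`. Colour an element `x` of an infinite set `X` according
to which coordinate of `F` strictly descends from the final segment of `X` at `x` to the next one;
badness ensures that one of them does. On a homogeneous set one coordinate descends forever, which
contradicts well-foundedness as soon as the descending sequence exists as a set. So two facts about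
`𝟑` are needed: it yields homogeneous sets (`IsColouring.exists_homogeneous`) and arithmetical
comprehension (`arithComprehension_of_three`).

For the first fact, suppose that no infinite set is homogeneous. Given `X`, let `i` be the colour of
its minimum and consider the distance from the minimum to the last element before the first change
of colour. Send `X` to `0` if this distance is odd, and to a value in `{1, 2}` determined by `i` if
it is even. Passing to the tail flips the parity, unless the distance is zero, in which case the
tail begins with the other colour. Either way the value changes, so the map is bad (`wit_tail`).

For the second fact, the same principle is applied to a colouring that asks whether a true stage of
an enumeration lies between consecutive elements of `X`. If the range of the enumeration is not a
set, then there are unboundedly many true stages, and homogeneous sets of either colour lead to a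
contradiction.

The order of these steps matters: the map into `𝟑` is `Σ⁰₂`-definable only if witnesses for the
colours can be bounded on initial segments of `X`. For the colouring by true stages this is checked
by hand; for the colouring by descents it follows from arithmetical comprehension. Definability is
tracked by type classes, so that most complexity bounds are found by instance search. -/

instance : Zero M.Num := ⟨M.zero⟩
instance : One M.Num := ⟨M.one⟩
instance : Add M.Num := ⟨M.add⟩
instance : Mul M.Num := ⟨M.mul⟩
instance : LT M.Num := ⟨M.lt⟩
instance : LE M.Num := ⟨fun a b => a < b ∨ a = b⟩
instance : Membership M.Num M.Sets := ⟨fun X a => a ∈ X.1⟩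

/-! ### Definability by terms and bounded formulas -/

/-- `f` is given by a number term in the first `n` variables. -/
class IsTm {n : ℕ} (f : (Fin n → M.Num) → M.Num) : Prop where
  ex : ∃ t : Term M, (∀ i ∈ t.vars, i < n) ∧ ∀ v : ℕ → M.Num, t.val v = f (fun i => v i)

/-- `P` is given by a bounded formula in the first `n` number variables and one set variable. -/
class IsD0 {n : ℕ} (P : (Fin n → M.Num) → M.Sets → Prop) : Prop where
  ex : ∃ θ : Formula M, θ.IsBounded ∧ ∀ v W, θ.Sat v W ↔ P (fun i => v i) (W 0)

section closure

variable {n : ℕ}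

instance IsTm.var (i : Fin n) : IsTm (M := M) (fun v => v i) :=
  ⟨.var i, by simp [Term.vars], fun _ => rfl⟩

instance IsTm.const (c : M.Num) : IsTm (n := n) (fun _ => c) :=
  ⟨.param c, by simp [Term.vars], fun _ => rfl⟩

instance IsTm.add (f g : (Fin n → M.Num) → M.Num) [hf : IsTm f] [hg : IsTm g] :
    IsTm (fun v => f v + g v) := by
  obtain ⟨s, hs, hs'⟩ := hf
  obtain ⟨t, ht, ht'⟩ := hg
  refine ⟨.add s t, ?_, fun v => ?_⟩
  · rintro i (h | h)
    exacts [hs i h, ht i h]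
  · rw [← hs', ← ht']
    rfl

instance IsTm.mul (f g : (Fin n → M.Num) → M.Num) [hf : IsTm f] [hg : IsTm g] :
    IsTm (fun v => f v * g v) := by
  obtain ⟨s, hs, hs'⟩ := hf
  obtain ⟨t, ht, ht'⟩ := hg
  refine ⟨.mul s t, ?_, fun v => ?_⟩
  · rintro i (h | h)
    exacts [hs i h, ht i h]
  · rw [← hs', ← ht']
    rfl

instance IsTm.pair (f g : (Fin n → M.Num) → M.Num) [hf : IsTm f] [hg : IsTm g] :
    IsTm (fun v => M.pair (f v) (g v)) :=
  inferInstanceAs (IsTm fun v => (f v + g v) * (f v + g v) + f v)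

theorem IsTm.weaken {f : (Fin n → M.Num) → M.Num} (hf : IsTm f) :
    IsTm (fun v : Fin (n + 1) → M.Num => f (fun i => v i.castSucc)) := by
  obtain ⟨t, ht, ht'⟩ := hf
  exact ⟨t, fun i hi => (ht i hi).trans (Nat.lt_succ_self n), ht'⟩

theorem IsD0.congr {P Q : (Fin n → M.Num) → M.Sets → Prop} (hP : IsD0 P)
    (h : ∀ v X, Q v X ↔ P v X) : IsD0 Q := by
  obtain ⟨θ, h1, h2⟩ := hP
  exact ⟨θ, h1, fun v W => (h2 v W).trans (h _ _).symm⟩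

instance IsD0.eq (f g : (Fin n → M.Num) → M.Num) [hf : IsTm f] [hg : IsTm g] :
    IsD0 (fun v _ => f v = g v) := by
  obtain ⟨s, hs, hs'⟩ := hf
  obtain ⟨t, ht, ht'⟩ := hg
  exact ⟨.eq s t, .eq s t, fun v W => by simp [Formula.Sat, hs', ht']⟩

instance IsD0.lt (f g : (Fin n → M.Num) → M.Num) [hf : IsTm f] [hg : IsTm g] :
    IsD0 (fun v _ => f v < g v) := by
  obtain ⟨s, hs, hs'⟩ := hf
  obtain ⟨t, ht, ht'⟩ := hg
  refine ⟨.lt s t, .lt s t, fun v W => ?_⟩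
  rw [← hs', ← ht']
  rfl

instance IsD0.mem (f : (Fin n → M.Num) → M.Num) [hf : IsTm f] :
    IsD0 (fun v X => f v ∈ X) := by
  obtain ⟨s, hs, hs'⟩ := hf
  refine ⟨.memVar s 0, .memVar s 0, fun v W => ?_⟩
  rw [← hs']
  rfl

instance IsD0.memParam (f : (Fin n → M.Num) → M.Num) (A : M.Sets) [hf : IsTm f] :
    IsD0 (fun v _ => f v ∈ A) := by
  obtain ⟨s, hs, hs'⟩ := hf
  refine ⟨.memParam s A, .memParam s A, fun v W => ?_⟩
  rw [← hs']
  rfl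

instance IsD0.not (P : (Fin n → M.Num) → M.Sets → Prop) [hP : IsD0 P] :
    IsD0 (fun v X => ¬ P v X) := by
  obtain ⟨θ, h1, h2⟩ := hP
  exact ⟨.neg θ, .neg h1, fun v W => not_congr (h2 v W)⟩

instance IsD0.and (P Q : (Fin n → M.Num) → M.Sets → Prop) [hP : IsD0 P] [hQ : IsD0 Q] :
    IsD0 (fun v X => P v X ∧ Q v X) := by
  obtain ⟨θ, h1, h2⟩ := hP
  obtain ⟨η, h3, h4⟩ := hQ
  exact ⟨.and θ η, .and h1 h3, fun v W => and_congr (h2 v W) (h4 v W)⟩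

instance IsD0.or (P Q : (Fin n → M.Num) → M.Sets → Prop) [hP : IsD0 P] [hQ : IsD0 Q] :
    IsD0 (fun v X => P v X ∨ Q v X) := by
  obtain ⟨θ, h1, h2⟩ := hP
  obtain ⟨η, h3, h4⟩ := hQ
  exact ⟨.or θ η, .or h1 h3, fun v W => or_congr (h2 v W) (h4 v W)⟩

instance IsD0.imp (P Q : (Fin n → M.Num) → M.Sets → Prop) [hP : IsD0 P] [hQ : IsD0 Q] :
    IsD0 (fun v X => P v X → Q v X) := by
  obtain ⟨θ, h1, h2⟩ := hP
  obtain ⟨η, h3, h4⟩ := hQ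
  exact ⟨.imp θ η, .imp h1 h3, fun v W => imp_congr (h2 v W) (h4 v W)⟩

instance IsD0.iff (P Q : (Fin n → M.Num) → M.Sets → Prop) [hP : IsD0 P] [hQ : IsD0 Q] :
    IsD0 (fun v X => P v X ↔ Q v X) :=
  IsD0.congr (P := fun v X => (P v X → Q v X) ∧ (Q v X → P v X)) inferInstance
    fun _ _ => iff_iff_implies_and_implies

theorem restrict_update (v : ℕ → M.Num) (a : M.Num) :
    (fun i : Fin n => Function.update v n a i) = fun i : Fin n => v i := by
  funext i
  exact Function.update_of_ne i.2.ne _ _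

instance IsD0.ball (f : (Fin n → M.Num) → M.Num) (P : M.Num → (Fin n → M.Num) → M.Sets → Prop)
    [hf : IsTm f]
    [hP : IsD0 (fun (v : Fin (n + 1) → M.Num) X => P (v (Fin.last n)) (fun i => v i.castSucc) X)] :
    IsD0 (fun v X => ∀ a, a < f v → P a v X) := by
  obtain ⟨t, ht, ht'⟩ := hf
  obtain ⟨θ, h1, h2⟩ := hP
  -- The quantified variable gets index `n`, which is fresh because `t` only uses variables below
  -- `n`.
  refine ⟨.allNum n (.imp (.lt (.var n) t) θ), .ball (fun h => (ht n h).false) h1, fun v W => ?_⟩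
  refine forall_congr' fun a => imp_congr ?_ ?_
  · change M.lt (Function.update v n a n) (t.val _) ↔ M.lt a _
    rw [ht', Function.update_self, restrict_update]
  · rw [h2]
    simp only [Fin.val_last, Function.update_self, Fin.val_castSucc, restrict_update]

instance IsD0.bex (f : (Fin n → M.Num) → M.Num) (P : M.Num → (Fin n → M.Num) → M.Sets → Prop)
    [hf : IsTm f]
    [hP : IsD0 (fun (v : Fin (n + 1) → M.Num) X => P (v (Fin.last n)) (fun i => v i.castSucc) X)] :
    IsD0 (fun v X => ∃ a, a < f v ∧ P a v X) :=
  IsD0.congr (P := fun v X => ¬ ∀ a, a < f v → ¬ P a v X) inferInstance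
    fun v X => by push Not; rfl

theorem IsD0.weaken {P : (Fin n → M.Num) → M.Sets → Prop} (hP : IsD0 P) :
    IsD0 (fun (v : Fin (n + 1) → M.Num) X => P (fun i => v i.castSucc) X) := by
  obtain ⟨θ, h1, h2⟩ := hP
  exact ⟨θ, h1, h2⟩

/-! ### Substitution into terms and bounded formulas -/

theorem Term.val_isTm (t : Term M) {m : ℕ} (σ : ℕ → (Fin m → M.Num) → M.Num)
    (hσ : ∀ i, IsTm (σ i)) : IsTm (fun v => t.val (fun i => σ i v)) := by
  induction t with
  | var i => exact hσ i
  | param c => exact IsTm.const c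
  | zero => exact IsTm.const 0
  | one => exact IsTm.const 1
  | add s t hs ht => exact IsTm.add _ _
  | mul s t hs ht => exact IsTm.mul _ _

theorem Term.val_update {t : Term M} {i : ℕ} (hi : i ∉ t.vars) (v : ℕ → M.Num) (a : M.Num) :
    t.val (Function.update v i a) = t.val v := by
  induction t with
  | var j => exact Function.update_of_ne (fun h => hi (by simp [Term.vars, h])) _ _
  | param c => rfl
  | zero => rfl
  | one => rfl
  | add s t hs ht =>
    simp only [Term.vars, Set.mem_union, not_or] at hi
    simp [Term.val, hs hi.1, ht hi.2]
  | mul s t hs ht =>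
    simp only [Term.vars, Set.mem_union, not_or] at hi
    simp [Term.val, hs hi.1, ht hi.2]

/-- Induction on `θ`. Under a quantifier the variable `j` is redirected to a new last variable, so
`σ` and `m` must be general. The condition on `T` allows arbitrary term substitutions `ρ` so that it
survives the addition of variables. -/
theorem Formula.sat_isD0 {θ : Formula M} (hθ : θ.IsBounded) : ∀ {m : ℕ}
    (σ : ℕ → (Fin m → M.Num) → M.Num) (_ : ∀ i, IsTm (σ i))
    (T : (Fin m → M.Num) → M.Sets → ℕ → M.Sets)
    (_ : ∀ (k : ℕ) {m' : ℕ} (τ : (Fin m' → M.Num) → M.Num) (ρ : (Fin m' → M.Num) → Fin m → M.Num),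
      IsTm τ → (∀ i, IsTm (fun v => ρ v i)) → IsD0 (fun v X => τ v ∈ T (ρ v) X k)),
    IsD0 (fun v X => θ.Sat (fun i => σ i v) (T v X)) := by
  have key : ∀ {m : ℕ} (σ : ℕ → (Fin m → M.Num) → M.Num) (j : ℕ) (v : Fin (m + 1) → M.Num),
      (fun i => Function.update (fun i (v : Fin (m + 1) → M.Num) => σ i (fun i => v i.castSucc)) j
        (fun v => v (Fin.last m)) i v) =
      Function.update (fun i => σ i (fun i => v i.castSucc)) j (v (Fin.last m)) := by
    intro m σ j v
    funext i
    by_cases h : i = j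
    · subst h; simp
    · simp [h]
  have key' : ∀ {m : ℕ} (σ : ℕ → (Fin m → M.Num) → M.Num) (j : ℕ) (_ : ∀ i, IsTm (σ i)) (i : ℕ),
      IsTm (Function.update (fun i (v : Fin (m + 1) → M.Num) => σ i (fun i => v i.castSucc)) j
        (fun v => v (Fin.last m)) i) := by
    intro m σ j hσ i
    by_cases h : i = j
    · subst h; simp only [Function.update_self]; infer_instance
    · simp only [Function.update_of_ne h]; exact (hσ i).weaken
  induction hθ with
  | eq s t =>
    intro m σ hσ T hT
    have := s.val_isTm σ hσ
    have := t.val_isTm σ hσ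
    exact IsD0.eq _ _
  | lt s t =>
    intro m σ hσ T hT
    have := s.val_isTm σ hσ
    have := t.val_isTm σ hσ
    exact IsD0.lt _ _
  | memVar t k =>
    intro m σ hσ T hT
    exact hT k _ (fun v => v) (t.val_isTm σ hσ) inferInstance
  | memParam t A =>
    intro m σ hσ T hT
    have := t.val_isTm σ hσ
    exact IsD0.memParam _ _
  | neg _ ih =>
    intro m σ hσ T hT
    have := ih σ hσ T hT
    exact IsD0.not _
  | and _ _ ih1 ih2 =>
    intro m σ hσ T hT
    have := ih1 σ hσ T hT
    have := ih2 σ hσ T hT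
    exact IsD0.and _ _
  | or _ _ ih1 ih2 =>
    intro m σ hσ T hT
    have := ih1 σ hσ T hT
    have := ih2 σ hσ T hT
    exact IsD0.or _ _
  | imp _ _ ih1 ih2 =>
    intro m σ hσ T hT
    have := ih1 σ hσ T hT
    have := ih2 σ hσ T hT
    exact IsD0.imp _ _
  | @ball j t φ hj _ ih =>
    intro m σ hσ T hT
    have h1 := t.val_isTm σ hσ
    have h2 := ih _ (key' σ j hσ) (fun v X => T (fun i => v i.castSucc) X)
      (fun k _ τ ρ hτ hρ => hT k τ _ hτ fun i => hρ i.castSucc)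
    simp only [key] at h2
    refine (IsD0.ball (fun v => t.val (fun i => σ i v))
      (fun a v X => φ.Sat (Function.update (fun i => σ i v) j a) (T v X))).congr fun v X => ?_
    simp only [Formula.Sat, Term.val, Function.update_self, Term.val_update hj]
    rfl
  | @bex j t φ hj _ ih =>
    intro m σ hσ T hT
    have h1 := t.val_isTm σ hσ
    have h2 := ih _ (key' σ j hσ) (fun v X => T (fun i => v i.castSucc) X)
      (fun k _ τ ρ hτ hρ => hT k τ _ hτ fun i => hρ i.castSucc)
    simp only [key] at h2
    refine (IsD0.bex (fun v => t.val (fun i => σ i v))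
      (fun a v X => φ.Sat (Function.update (fun i => σ i v) j a) (T v X))).congr fun v X => ?_
    simp only [Formula.Sat, Term.val, Function.update_self, Term.val_update hj]
    rfl

/-- Bounded definability is preserved when numbers are replaced by terms and the set by a set that
is uniformly definable by bounded formulas. -/
theorem IsD0.subst {P : (Fin n → M.Num) → M.Sets → Prop} (hP : IsD0 P) {m : ℕ}
    (σ : Fin n → (Fin m → M.Num) → M.Num) (hσ : ∀ i, IsTm (σ i))
    (T : (Fin m → M.Num) → M.Sets → M.Sets)
    (hT : ∀ {m' : ℕ} (τ : (Fin m' → M.Num) → M.Num) (ρ : (Fin m' → M.Num) → Fin m → M.Num),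
      IsTm τ → (∀ i, IsTm (fun v => ρ v i)) → IsD0 (fun v X => τ v ∈ T (ρ v) X)) :
    IsD0 (fun v X => P (fun i => σ i v) (T v X)) := by
  obtain ⟨θ, h1, h2⟩ := hP
  -- Variables with index at least `n` receive the dummy value `0`, which `P` does not see.
  refine (Formula.sat_isD0 h1 (fun i v => if h : i < n then σ ⟨i, h⟩ v else 0) (fun i => ?_)
    (fun v X _ => T v X) (fun _ _ => hT)).congr fun v X => ?_
  · by_cases h : i < n
    · simp only [h, dif_pos]; exact hσ _
    · simp only [h, dif_neg, not_false_eq_true]; infer_instance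
  · rw [h2]; simp

/-- Number variables can be replaced by terms. -/
theorem IsD0.comp {P : (Fin n → M.Num) → M.Sets → Prop} (hP : IsD0 P) {m : ℕ}
    (σ : Fin n → (Fin m → M.Num) → M.Num) (hσ : ∀ i, IsTm (σ i)) :
    IsD0 (fun v X => P (fun i => σ i v) X) :=
  hP.subst σ hσ (fun _ X => X) fun _ _ _ _ => inferInstance

/-- Number variables can be replaced by terms and the set variable by a parameter. -/
theorem IsD0.comp_param {P : (Fin n → M.Num) → M.Sets → Prop} (hP : IsD0 P) {m : ℕ}
    (σ : Fin n → (Fin m → M.Num) → M.Num) (hσ : ∀ i, IsTm (σ i)) (A : M.Sets) :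
    IsD0 (fun v _ => P (fun i => σ i v) A) :=
  hP.subst σ hσ (fun _ _ => A) fun _ _ _ _ => inferInstance

end closure

/-! ### `Σ⁰₁`-definability -/

/-- `P` is given by a `Σ⁰₁`-formula in the first `n` number variables and one set variable. -/
class IsS1 {n : ℕ} (P : (Fin n → M.Num) → M.Sets → Prop) : Prop where
  ex : ∃ Q : M.Num → (Fin n → M.Num) → M.Sets → Prop,
    IsD0 (fun (v : Fin (n + 1) → M.Num) X => Q (v (Fin.last n)) (fun i => v i.castSucc) X) ∧
    ∀ v X, P v X ↔ ∃ b, Q b v X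

instance (priority := 50) IsS1.of_isD0 {n : ℕ} (P : (Fin n → M.Num) → M.Sets → Prop)
    [hP : IsD0 P] : IsS1 P :=
  ⟨fun _ v X => P v X, hP.weaken, fun _ _ => ⟨fun h => ⟨0, h⟩, fun ⟨_, h⟩ => h⟩⟩

theorem IsS1.ex_isD0 {n : ℕ} (P : M.Num → (Fin n → M.Num) → M.Sets → Prop)
    (hP : IsD0 (fun (v : Fin (n + 1) → M.Num) X => P (v (Fin.last n)) (fun i => v i.castSucc) X)) :
    IsS1 (fun v X => ∃ a, P a v X) :=
  ⟨P, hP, fun _ _ => Iff.rfl⟩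

theorem IsS1.congr {n : ℕ} {P Q : (Fin n → M.Num) → M.Sets → Prop} (hP : IsS1 P)
    (h : ∀ v X, Q v X ↔ P v X) : IsS1 Q := by
  obtain ⟨R, h1, h2⟩ := hP
  exact ⟨R, h1, fun v X => (h v X).trans (h2 v X)⟩

theorem IsS1.exists_formula {n : ℕ} {P : (Fin n → M.Num) → M.Sets → Prop} (hP : IsS1 P) :
    ∃ φ : Formula M, φ.IsSigma01 ∧ ∀ v W, φ.Sat v W ↔ P (fun i => v i) (W 0) := by
  obtain ⟨Q, ⟨θ, h1, h2⟩, h3⟩ := hP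
  refine ⟨.exNum n θ, ⟨n, θ, h1, rfl⟩, fun v W => ?_⟩
  rw [h3]
  refine exists_congr fun a => ?_
  rw [h2]
  simp only [Fin.val_last, Function.update_self, Fin.val_castSucc, restrict_update]

theorem pair_eq (a b : M.Num) : M.pair a b = (a + b) * (a + b) + a := rfl

section model

variable [hM : Fact M.IsModelRCA0]

/-- Parameters enter through constants inside `P`, so the axiom is only needed for a dummy
assignment. -/
theorem induction_S1 (P : M.Num → Prop) (hP : IsS1 (fun (v : Fin 1 → M.Num) (_ : M.Sets) => P (v 0)))
    (zero : P 0) (succ : ∀ n, P n → P (n + 1)) (n : M.Num) : P n := by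
  obtain ⟨φ, h1, h2⟩ := hP.exists_formula
  obtain ⟨A, hA⟩ := M.sets_nonempty
  have := hM.out.sigma01_induction φ h1 (fun _ => 0) (fun _ => ⟨A, hA⟩) 0
  simp only [h2, Fin.val_zero, Function.update_self] at this
  exact this zero succ n

theorem induction_D0 (P : M.Num → Prop)
    (hP : IsD0 (fun (v : Fin 1 → M.Num) (_ : M.Sets) => P (v 0)))
    (zero : P 0) (succ : ∀ n, P n → P (n + 1)) (n : M.Num) : P n :=
  induction_S1 P inferInstance zero succ n

/-! ### Arithmetic -/

protected theorem add_zero' (a : M.Num) : a + 0 = a := hM.out.add_zero a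
protected theorem add_succ' (a b : M.Num) : a + (b + 1) = a + b + 1 := hM.out.add_succ a b
protected theorem mul_zero' (a : M.Num) : a * 0 = 0 := hM.out.mul_zero a
protected theorem mul_succ' (a b : M.Num) : a * (b + 1) = a * b + a := hM.out.mul_succ a b
protected theorem lt_succ' {a b : M.Num} : a < b + 1 ↔ a < b ∨ a = b := hM.out.lt_succ_iff a b
protected theorem not_lt_zero' (a : M.Num) : ¬ a < 0 := hM.out.not_lt_zero a
protected theorem succ_ne_zero' (a : M.Num) : a + 1 ≠ 0 := hM.out.succ_ne_zero a
protected theorem succ_inj' {a b : M.Num} (h : a + 1 = b + 1) : a = b := hM.out.succ_inj a b h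

protected theorem add_assoc' (a b c : M.Num) : a + b + c = a + (b + c) := by
  refine induction_D0 (fun c => a + b + c = a + (b + c)) inferInstance ?_ (fun c ih => ?_) c
  · simp only [L2Structure.add_zero']
  · simp only [L2Structure.add_succ', ih]

protected theorem zero_add' (a : M.Num) : 0 + a = a := by
  refine induction_D0 (fun c => 0 + c = c) inferInstance ?_ (fun c ih => ?_) a
  · simp only [L2Structure.add_zero']
  · simp only [L2Structure.add_succ', ih]

protected theorem succ_add' (a b : M.Num) : a + 1 + b = a + b + 1 := by
  refine induction_D0 (fun c => a + 1 + c = a + c + 1) inferInstance ?_ (fun c ih => ?_) b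
  · simp only [L2Structure.add_zero']
  · simp only [L2Structure.add_succ', ih]

protected theorem add_comm' (a b : M.Num) : a + b = b + a := by
  refine induction_D0 (fun c => a + c = c + a) inferInstance ?_ (fun c ih => ?_) b
  · simp only [L2Structure.add_zero', L2Structure.zero_add']
  · simp only [L2Structure.add_succ', L2Structure.succ_add', ih]

protected theorem zero_mul' (a : M.Num) : 0 * a = 0 := by
  refine induction_D0 (fun c => 0 * c = 0) inferInstance ?_ (fun c ih => ?_) a
  · simp only [L2Structure.mul_zero']
  · simp only [L2Structure.mul_succ', ih, L2Structure.add_zero']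

protected theorem succ_mul' (a b : M.Num) : (a + 1) * b = a * b + b := by
  refine induction_D0 (fun c => (a + 1) * c = a * c + c) inferInstance ?_ (fun c ih => ?_) b
  · simp only [L2Structure.mul_zero', L2Structure.add_zero']
  · rw [L2Structure.mul_succ', L2Structure.mul_succ', ih, L2Structure.add_succ',
      L2Structure.add_succ', L2Structure.add_assoc' _ c, L2Structure.add_comm' c a,
      ← L2Structure.add_assoc']

protected theorem mul_comm' (a b : M.Num) : a * b = b * a := by
  refine induction_D0 (fun c => a * c = c * a) inferInstance ?_ (fun c ih => ?_) b
  · simp only [L2Structure.mul_zero', L2Structure.zero_mul']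
  · simp only [L2Structure.mul_succ', L2Structure.succ_mul', ih]

protected theorem mul_add' (a b c : M.Num) : a * (b + c) = a * b + a * c := by
  refine induction_D0 (fun c => a * (b + c) = a * b + a * c) inferInstance ?_ (fun c ih => ?_) c
  · simp only [L2Structure.mul_zero', L2Structure.add_zero']
  · rw [L2Structure.add_succ', L2Structure.mul_succ', L2Structure.mul_succ', ih,
      L2Structure.add_assoc']

protected theorem mul_assoc' (a b c : M.Num) : a * b * c = a * (b * c) := by
  refine induction_D0 (fun c => a * b * c = a * (b * c)) inferInstance ?_ (fun c ih => ?_) c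
  · simp only [L2Structure.mul_zero']
  · rw [L2Structure.mul_succ', L2Structure.mul_succ', L2Structure.mul_add', ih]

protected theorem mul_one' (a : M.Num) : a * 1 = a := by
  have := L2Structure.mul_succ' a 0
  rwa [L2Structure.zero_add', L2Structure.mul_zero', L2Structure.zero_add'] at this

instance : CommSemiring M.Num where
  add_assoc := L2Structure.add_assoc'
  zero_add := L2Structure.zero_add'
  add_zero := L2Structure.add_zero'
  add_comm := L2Structure.add_comm'
  mul_assoc := L2Structure.mul_assoc'
  one_mul a := by rw [L2Structure.mul_comm', L2Structure.mul_one']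
  mul_one := L2Structure.mul_one'
  mul_comm := L2Structure.mul_comm'
  left_distrib := L2Structure.mul_add'
  right_distrib a b c := by
    rw [L2Structure.mul_comm', L2Structure.mul_add', L2Structure.mul_comm' c a,
      L2Structure.mul_comm' c b]
  zero_mul := L2Structure.zero_mul'
  mul_zero := L2Structure.mul_zero'
  nsmul := nsmulRec
  npow := npowRec

protected theorem add_left_cancel' {a b c : M.Num} (h : a + b = a + c) : b = c := by
  revert h
  refine induction_D0 (fun a => a + b = a + c → b = c) inferInstance ?_ (fun a ih h => ?_) a
  · simp
  · refine ih (L2Structure.succ_inj' ?_)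
    rwa [add_right_comm, add_right_comm a c]

/-! ### The order on the numbers -/

protected theorem lt_iff' {a b : M.Num} : a < b ↔ ∃ c, a + c + 1 = b := by
  constructor
  · refine fun h => (?_ : ∃ c, a < b → a + c + 1 = b).imp fun c hc => hc h
    -- The premise `a < b` stands behind the quantifier so that the induction formula is `Σ⁰₁`.
    refine induction_S1 (fun b => ∃ c, a < b → a + c + 1 = b)
      (IsS1.ex_isD0 _ inferInstance) ?_ (fun b ⟨c, hc⟩ => ?_) b
    · exact ⟨0, fun h => (L2Structure.not_lt_zero' _ h).elim⟩
    · by_cases h : a < b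
      · exact ⟨c + 1, fun _ => by rw [← add_assoc, hc h]⟩
      · refine ⟨0, fun h' => ?_⟩
        obtain rfl := (L2Structure.lt_succ'.1 h').resolve_left h
        simp
  · rintro ⟨c, rfl⟩
    refine induction_D0 (fun c => a < a + c + 1) inferInstance ?_ (fun c ih => ?_) c
    · exact L2Structure.lt_succ'.2 (.inr (by simp))
    · rw [← add_assoc]
      exact L2Structure.lt_succ'.2 (.inl ih)

protected theorem lt_irrefl' (a : M.Num) : ¬ a < a := by
  rw [L2Structure.lt_iff']
  rintro ⟨c, hc⟩
  have : a + (c + 1) = a + 0 := by rw [← add_assoc, hc, add_zero]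
  exact L2Structure.succ_ne_zero' _ (L2Structure.add_left_cancel' this)

protected theorem lt_trans' {a b c : M.Num} (h : a < b) (h' : b < c) : a < c := by
  rw [L2Structure.lt_iff'] at *
  obtain ⟨d, rfl⟩ := h
  obtain ⟨e, rfl⟩ := h'
  exact ⟨d + 1 + e, by ring⟩

protected theorem lt_trichotomy' (a b : M.Num) : a < b ∨ a = b ∨ b < a := by
  refine induction_D0 (fun a => a < b ∨ a = b ∨ b < a) inferInstance ?_ (fun a ih => ?_) a
  · refine induction_D0 (fun b => 0 < b ∨ 0 = b ∨ b < 0) inferInstance ?_ (fun b _ => ?_) b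
    · simp
    · exact .inl (L2Structure.lt_iff'.2 ⟨b, by simp⟩)
  · rcases ih with h | rfl | h
    · obtain ⟨c, rfl⟩ := L2Structure.lt_iff'.1 h
      refine induction_D0 (fun c => a + 1 < a + c + 1 ∨ a + 1 = a + c + 1 ∨ a + c + 1 < a + 1)
        inferInstance ?_ (fun c _ => ?_) c
      · simp
      · exact .inl (L2Structure.lt_iff'.2 ⟨c, by ring⟩)
    · exact .inr (.inr (L2Structure.lt_succ'.2 (.inr rfl)))
    · exact .inr (.inr (L2Structure.lt_succ'.2 (.inl h)))

noncomputable instance : LinearOrder M.Num where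
  le_refl a := .inr rfl
  le_trans a b c := by
    rintro (h | rfl) (h' | rfl)
    exacts [.inl (L2Structure.lt_trans' h h'), .inl h, .inl h', .inr rfl]
  lt_iff_le_not_ge a b := by
    constructor
    · refine fun h => ⟨.inl h, ?_⟩
      rintro (h' | rfl)
      exacts [L2Structure.lt_irrefl' _ (L2Structure.lt_trans' h h'), L2Structure.lt_irrefl' _ h]
    · rintro ⟨h | rfl, h'⟩
      exacts [h, (h' (.inr rfl)).elim]
  le_antisymm a b := by
    rintro (h | rfl) (h' | h')
    exacts [(L2Structure.lt_irrefl' _ (L2Structure.lt_trans' h h')).elim, h'.symm, rfl, rfl]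
  le_total a b := by
    rcases L2Structure.lt_trichotomy' a b with h | h | h
    exacts [.inl (.inl h), .inl (.inr h), .inr (.inl h)]
  toDecidableLE := Classical.decRel _

theorem lt_add_one_iff {a b : M.Num} : a < b + 1 ↔ a ≤ b := L2Structure.lt_succ'

protected theorem le_iff' {a b : M.Num} : a ≤ b ↔ ∃ c, b = a + c := by
  rw [← lt_add_one_iff, L2Structure.lt_iff']
  refine exists_congr fun c => ⟨fun h => (L2Structure.succ_inj' h).symm, ?_⟩
  rintro rfl; rfl

instance : IsOrderedRing M.Num where
  add_le_add_left a b h c := by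
    obtain ⟨d, rfl⟩ := L2Structure.le_iff'.1 h
    exact L2Structure.le_iff'.2 ⟨d, by ring⟩
  zero_le_one := L2Structure.le_iff'.2 ⟨1, by simp⟩
  mul_le_mul_of_nonneg_left c _ a b h := by
    obtain ⟨d, rfl⟩ := L2Structure.le_iff'.1 h
    exact L2Structure.le_iff'.2 ⟨c * d, mul_add _ _ _⟩
  mul_le_mul_of_nonneg_right c _ a b h := by
    obtain ⟨d, rfl⟩ := L2Structure.le_iff'.1 h
    exact L2Structure.le_iff'.2 ⟨d * c, add_mul _ _ _⟩

instance : IsStrictOrderedRing M.Num where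
  le_of_add_le_add_left a b c h := by
    obtain ⟨d, hd⟩ := L2Structure.le_iff'.1 h
    rw [add_assoc] at hd
    exact L2Structure.le_iff'.2 ⟨d, L2Structure.add_left_cancel' hd⟩
  mul_lt_mul_of_pos_left c hc a b h := by
    obtain ⟨d, rfl⟩ := L2Structure.lt_iff'.1 h
    obtain ⟨e, rfl⟩ := L2Structure.lt_iff'.1 hc
    -- With `c = e + 1` and `b = a + d + 1`, the products differ by `d * (e + 1) + e + 1`.
    exact L2Structure.lt_iff'.2 ⟨a * 0 + d * (0 + e + 1) + e, by ring⟩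
  mul_lt_mul_of_pos_right c hc a b h := by
    obtain ⟨d, rfl⟩ := L2Structure.lt_iff'.1 h
    obtain ⟨e, rfl⟩ := L2Structure.lt_iff'.1 hc
    exact L2Structure.lt_iff'.2 ⟨a * 0 + d * (0 + e + 1) + e, by ring⟩
  exists_pair_ne := ⟨0 + 1, 0, L2Structure.succ_ne_zero' 0⟩

instance : CanonicallyOrderedAdd M.Num where
  exists_add_of_le h := L2Structure.le_iff'.1 h
  le_self_add _ b := L2Structure.le_iff'.2 ⟨b, rfl⟩
  le_add_self _ b := L2Structure.le_iff'.2 ⟨b, add_comm _ _⟩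

theorem add_one_le_iff {a b : M.Num} : a + 1 ≤ b ↔ a < b := by
  rw [← lt_add_one_iff, add_lt_add_iff_right]

/-! ### The pairing function -/

theorem left_le_pair (a b : M.Num) : a ≤ M.pair a b := le_add_self

theorem right_le_pair (a b : M.Num) : b ≤ M.pair a b := by
  rw [pair_eq]
  rcases eq_or_ne b 0 with rfl | h
  · exact zero_le
  · have h1 : 1 ≤ b := by rw [← zero_add 1]; exact add_one_le_iff.2 (pos_iff_ne_zero.2 h)
    calc b = b * 1 := (mul_one b).symm
      _ ≤ (a + b) * (a + b) := mul_le_mul' le_add_self (h1.trans le_add_self)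
      _ ≤ _ := le_self_add

/-- The code lies in the interval from `(a + b)²` to `(a + b + 1)²`, excluding the right end, so it
determines `a + b` and then `a`. -/
theorem pair_inj {a b c d : M.Num} : M.pair a b = M.pair c d ↔ a = c ∧ b = d := by
  refine ⟨fun h => ?_, by rintro ⟨rfl, rfl⟩; rfl⟩
  have key : ∀ a b c d : M.Num, M.pair a b = M.pair c d → ¬ a + b < c + d := by
    intro a b c d h hlt
    have h1 : (a + b + 1) * (a + b + 1) ≤ (c + d) * (c + d) :=
      mul_le_mul' (add_one_le_iff.2 hlt) (add_one_le_iff.2 hlt)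
    have h2 : M.pair a b < (a + b + 1) * (a + b + 1) := by
      have e : (a + b + 1) * (a + b + 1) = M.pair a b + (a + b + b) + 1 := by
        rw [pair_eq]; ring
      rw [e, lt_add_one_iff]
      exact le_self_add
    have h3 : (c + d) * (c + d) ≤ M.pair c d := le_self_add
    exact (h2.trans_le (h1.trans h3)).ne h
  have hs : a + b = c + d := le_antisymm (not_lt.1 (key _ _ _ _ h.symm)) (not_lt.1 (key _ _ _ _ h))
  have ha : a = c := by
    rw [pair_eq, pair_eq, hs] at h
    exact add_left_cancel h
  exact ⟨ha, by rw [ha] at hs; exact add_left_cancel hs⟩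

end model
end L2Structure

namespace L2Structure

variable {M : L2Structure.{u}} {n : ℕ}

/-! ### Further bounded predicates -/

instance IsD0.le (f g : (Fin n → M.Num) → M.Num) [IsTm f] [IsTm g] :
    IsD0 (fun v _ => f v ≤ g v) :=
  inferInstanceAs (IsD0 fun v _ => f v < g v ∨ f v = g v)

theorem isTm_snoc {m : ℕ} (σ : Fin n → (Fin m → M.Num) → M.Num) (τ : (Fin m → M.Num) → M.Num)
    (hσ : ∀ i, IsTm (σ i)) (hτ : IsTm τ) (i : Fin (n + 1)) :
    IsTm (Fin.snoc (α := fun _ => (Fin m → M.Num) → M.Num) σ τ i) := by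
  induction i using Fin.lastCases with
  | last => simpa
  | cast i => simpa using hσ i

theorem IsD0.comp_snoc {Q : M.Num → (Fin n → M.Num) → M.Sets → Prop}
    (hQ : IsD0 (fun (v : Fin (n + 1) → M.Num) X => Q (v (Fin.last n)) (fun i => v i.castSucc) X))
    {m : ℕ} (τ : (Fin m → M.Num) → M.Num) (hτ : IsTm τ)
    (σ : Fin n → (Fin m → M.Num) → M.Num) (hσ : ∀ i, IsTm (σ i)) :
    IsD0 (fun v X => Q (τ v) (fun i => σ i v) X) := by
  have := hQ.comp _ (isTm_snoc σ τ hσ hτ)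
  simpa only [Fin.snoc_last, Fin.snoc_castSucc] using this

section model

variable [hM : Fact M.IsModelRCA0]

instance IsD0.ball_le (f : (Fin n → M.Num) → M.Num) (P : M.Num → (Fin n → M.Num) → M.Sets → Prop)
    [IsTm f]
    [IsD0 (fun (v : Fin (n + 1) → M.Num) X => P (v (Fin.last n)) (fun i => v i.castSucc) X)] :
    IsD0 (fun v X => ∀ a, a ≤ f v → P a v X) :=
  IsD0.congr (P := fun v X => ∀ a, a < f v + 1 → P a v X) inferInstance fun v X => by
    simp only [lt_add_one_iff]

instance IsD0.bex_le (f : (Fin n → M.Num) → M.Num) (P : M.Num → (Fin n → M.Num) → M.Sets → Prop)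
    [IsTm f]
    [IsD0 (fun (v : Fin (n + 1) → M.Num) X => P (v (Fin.last n)) (fun i => v i.castSucc) X)] :
    IsD0 (fun v X => ∃ a, a ≤ f v ∧ P a v X) :=
  IsD0.congr (P := fun v X => ∃ a, a < f v + 1 ∧ P a v X) inferInstance fun v X => by
    simp only [lt_add_one_iff]

theorem le_mul_right_of_ne_zero {a b : M.Num} (h : b ≠ 0) : a ≤ a * b := by
  have h1 : 1 ≤ b := by rw [← zero_add 1]; exact add_one_le_iff.2 (pos_iff_ne_zero.2 h)
  simpa using mul_le_mul_right h1 a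

instance IsD0.dvd (f g : (Fin n → M.Num) → M.Num) [hf : IsTm f] [hg : IsTm g] :
    IsD0 (fun v _ => f v ∣ g v) :=
  have := hf.weaken
  have := hg.weaken
  -- The quotient is bounded by `g v`, except for divisor `0`, where it can be chosen as `0`.
  IsD0.congr (P := fun v _ => ∃ d, d ≤ g v ∧ g v = f v * d) inferInstance fun v _ => by
    refine ⟨fun ⟨d, hd⟩ => ?_, fun ⟨d, _, hd⟩ => ⟨d, hd⟩⟩
    rcases eq_or_ne (f v) 0 with h | h
    · exact ⟨0, zero_le, by simp [hd, h]⟩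
    · exact ⟨d, by rw [hd, mul_comm]; exact le_mul_right_of_ne_zero h, hd⟩

/-! ### Collection -/

theorem collection_D0 (Q : M.Num → M.Num → Prop)
    (hQ : IsD0 (fun (v : Fin 2 → M.Num) (_ : M.Sets) => Q (v 0) (v 1))) (n : M.Num)
    (h : ∀ i < n, ∃ j, Q i j) : ∃ b, ∀ i < n, ∃ j < b, Q i j := by
  suffices H : ∃ b, n ≤ n → ∀ i < n, ∃ j < b, Q i j from H.imp fun _ hb => hb le_rfl
  have hQ' : ∀ {m : ℕ} (f g : (Fin m → M.Num) → M.Num) [IsTm f] [IsTm g],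
      IsD0 (fun v (_ : M.Sets) => Q (f v) (g v)) := fun f g _ _ =>
    hQ.comp ![f, g] (fun i => by fin_cases i <;> simpa)
  -- The guard `k ≤ n` makes the statement trivial beyond `n`; placed behind `∃ b` it keeps the
  -- formula `Σ⁰₁`.
  refine induction_S1 (fun k => ∃ b, k ≤ n → ∀ i < k, ∃ j < b, Q i j)
    (IsS1.ex_isD0 _ inferInstance) ?_ (fun k ⟨b, hb⟩ => ?_) n
  · exact ⟨0, fun _ i hi => (not_lt_zero hi).elim⟩
  · by_cases hk : k < n
    · obtain ⟨j, hj⟩ := h k hk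
      refine ⟨b + j + 1, fun _ i hi => ?_⟩
      rcases (lt_add_one_iff.1 hi).lt_or_eq with hi | rfl
      · obtain ⟨l, hl, hl'⟩ := hb hk.le i hi
        exact ⟨l, hl.trans_le (by rw [add_assoc]; exact le_self_add), hl'⟩
      · exact ⟨j, lt_add_one_iff.2 le_add_self, hj⟩
    · exact ⟨0, fun h => (hk (add_one_le_iff.1 h)).elim⟩

/-! ### Closure properties of `Σ⁰₁` -/

/-- Merges two unbounded quantifiers into one by a common bound, so that no decoding of pairs is
needed. -/
theorem exists_bounds₂ {P : M.Num → M.Num → Prop} :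
    (∃ a b, P a b) ↔ ∃ c, ∃ a < c, ∃ b < c, P a b := by
  refine ⟨fun ⟨a, b, h⟩ => ⟨a + b + 1, a, ?_, b, ?_, h⟩, fun ⟨_, a, _, b, _, h⟩ => ⟨a, b, h⟩⟩
  · exact lt_add_one_iff.2 le_self_add
  · exact lt_add_one_iff.2 le_add_self

instance IsS1.or (P Q : (Fin n → M.Num) → M.Sets → Prop) [hP : IsS1 P] [hQ : IsS1 Q] :
    IsS1 (fun v X => P v X ∨ Q v X) := by
  obtain ⟨A, h1, h2⟩ := hP
  obtain ⟨B, h3, h4⟩ := hQ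
  exact ⟨fun b v X => A b v X ∨ B b v X, IsD0.or _ _, fun v X => by rw [h2, h4, exists_or]⟩

instance IsS1.ex_isS1 (P : M.Num → (Fin n → M.Num) → M.Sets → Prop)
    [hP : IsS1 (fun (v : Fin (n + 1) → M.Num) X => P (v (Fin.last n)) (fun i => v i.castSucc) X)] :
    IsS1 (fun v X => ∃ a, P a v X) := by
  obtain ⟨A, h1, h2⟩ := hP
  have h3 : ∀ a v X, P a v X ↔ ∃ b, A b (Fin.snoc v a) X := fun a v X => by
    simpa using h2 (Fin.snoc v a) X
  refine (IsS1.ex_isD0 (fun c v X => ∃ a < c, ∃ b < c, A b (Fin.snoc v a) X) ?_).congr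
    fun v X => ?_
  · have : IsD0 fun (w : Fin (n + 3) → M.Num) X => A (w (Fin.last _))
        (Fin.snoc (fun i : Fin n => w i.castSucc.castSucc.castSucc) (w (Fin.last _).castSucc)) X := by
      refine (h1.comp_snoc (fun w : Fin (n + 3) → M.Num => w (Fin.last _)) inferInstance
        _ (isTm_snoc (fun (i : Fin n) (w : Fin (n + 3) → M.Num) => w i.castSucc.castSucc.castSucc)
          (fun w => w (Fin.last _).castSucc) (fun _ => inferInstance)
          inferInstance)).congr fun w X => ?_
      apply iff_of_eq
      congr 1
      funext i
      induction i using Fin.lastCases <;> simp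
    infer_instance
  · simp only [h3]
    exact exists_bounds₂

omit hM in
theorem IsD0.collapse {Q : M.Num → (Fin n → M.Num) → M.Sets → Prop}
    (hQ : IsD0 (fun (v : Fin (n + 1) → M.Num) X => Q (v (Fin.last n)) (fun i => v i.castSucc) X)) :
    IsD0 (fun (v : Fin (n + 1) → M.Num) X => ∃ c < v (Fin.last n), Q c (fun i => v i.castSucc) X) := by
  have : IsD0 fun (w : Fin (n + 2) → M.Num) X => Q (w (Fin.last _))
      (fun i => w i.castSucc.castSucc) X :=
    hQ.comp_snoc _ inferInstance (fun i w => w i.castSucc.castSucc) fun _ => inferInstance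
  infer_instance

instance IsS1.and (P Q : (Fin n → M.Num) → M.Sets → Prop) [hP : IsS1 P] [hQ : IsS1 Q] :
    IsS1 (fun v X => P v X ∧ Q v X) := by
  obtain ⟨A, h1, h2⟩ := hP
  obtain ⟨B, h3, h4⟩ := hQ
  have := h1.collapse
  have := h3.collapse
  refine ⟨fun c v X => (∃ a < c, A a v X) ∧ ∃ b < c, B b v X, IsD0.and _ _, fun v X => ?_⟩
  rw [h2, h4]
  constructor
  · rintro ⟨⟨a, ha⟩, b, hb⟩
    exact ⟨a + b + 1, ⟨a, lt_add_one_iff.2 le_self_add, ha⟩, b, lt_add_one_iff.2 le_add_self, hb⟩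
  · rintro ⟨c, ⟨a, _, ha⟩, b, _, hb⟩
    exact ⟨⟨a, ha⟩, b, hb⟩

/-- By collection, the witnesses for all `a < f v` have a common bound, which becomes the single
unbounded quantifier. -/
instance IsS1.ball (f : (Fin n → M.Num) → M.Num) (P : M.Num → (Fin n → M.Num) → M.Sets → Prop)
    [hf : IsTm f]
    [hP : IsS1 (fun (v : Fin (n + 1) → M.Num) X => P (v (Fin.last n)) (fun i => v i.castSucc) X)] :
    IsS1 (fun v X => ∀ a, a < f v → P a v X) := by
  obtain ⟨A, h1, h2⟩ := hP
  have h3 : ∀ a v X, P a v X ↔ ∃ b, A b (Fin.snoc v a) X := fun a v X => by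
    simpa using h2 (Fin.snoc v a) X
  refine (IsS1.ex_isD0 (fun c v X => ∀ a < f v, ∃ b < c, A b (Fin.snoc v a) X) ?_).congr
    fun v X => ?_
  · have : IsD0 fun (w : Fin (n + 3) → M.Num) X => A (w (Fin.last _))
        (Fin.snoc (fun i : Fin n => w i.castSucc.castSucc.castSucc) (w (Fin.last _).castSucc)) X := by
      refine (h1.comp_snoc (fun w : Fin (n + 3) → M.Num => w (Fin.last _)) inferInstance
        _ (isTm_snoc (fun (i : Fin n) (w : Fin (n + 3) → M.Num) => w i.castSucc.castSucc.castSucc)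
          (fun w => w (Fin.last _).castSucc) (fun _ => inferInstance)
          inferInstance)).congr fun w X => ?_
      apply iff_of_eq
      congr 1
      funext i
      induction i using Fin.lastCases <;> simp
    have := hf.weaken
    infer_instance
  · simp only [h3]
    refine ⟨fun h => collection_D0 (fun a b => A b (Fin.snoc v a) X) ?_ (f v) h,
      fun ⟨c, hc⟩ a ha => (hc a ha).imp fun b hb => hb.2⟩
    refine (h1.comp_param (Fin.snoc (α := fun _ => (Fin 2 → M.Num) → M.Num)
      (Fin.snoc (α := fun _ => (Fin 2 → M.Num) → M.Num) (fun i _ => v i)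
        (fun w => w 0)) fun w => w 1) ?_ X).congr fun w _ => ?_
    · exact isTm_snoc _ _ (isTm_snoc _ _ (fun _ => inferInstance) inferInstance) inferInstance
    · apply iff_of_eq
      simp only [Fin.snoc_last, Fin.snoc_castSucc]
      congr 1
      funext i
      induction i using Fin.lastCases <;> simp

/-! ### `Π⁰₁`- and `Σ⁰₂`-definability -/

/-- `P` is given by a `Π⁰₁`-formula. -/
class IsP1 (P : (Fin n → M.Num) → M.Sets → Prop) : Prop where
  not : IsS1 (fun v X => ¬ P v X)

/-- `P` is given by a `Σ⁰₂`-formula. -/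
class IsS2 (P : (Fin n → M.Num) → M.Sets → Prop) : Prop where
  ex : ∃ Q : M.Num → (Fin n → M.Num) → M.Sets → Prop,
    IsP1 (fun (v : Fin (n + 1) → M.Num) X => Q (v (Fin.last n)) (fun i => v i.castSucc) X) ∧
    ∀ v X, P v X ↔ ∃ b, Q b v X

instance IsS1.not (P : (Fin n → M.Num) → M.Sets → Prop) [hP : IsP1 P] :
    IsS1 (fun v X => ¬ P v X) := hP.not

instance IsS1.imp (P Q : (Fin n → M.Num) → M.Sets → Prop) [hP : IsP1 P] [hQ : IsS1 Q] :
    IsS1 (fun v X => P v X → Q v X) :=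
  IsS1.congr (P := fun v X => ¬ P v X ∨ Q v X) inferInstance fun _ _ => imp_iff_not_or

omit hM in
theorem IsP1.congr {P Q : (Fin n → M.Num) → M.Sets → Prop} (hP : IsP1 P)
    (h : ∀ v X, Q v X ↔ P v X) : IsP1 Q :=
  ⟨hP.not.congr fun v X => not_congr (h v X)⟩

instance (priority := 50) IsP1.of_isD0 (P : (Fin n → M.Num) → M.Sets → Prop) [hP : IsD0 P] :
    IsP1 P :=
  ⟨IsS1.of_isD0 _⟩

instance IsP1.not_isS1 (P : (Fin n → M.Num) → M.Sets → Prop) [hP : IsS1 P] :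
    IsP1 (fun v X => ¬ P v X) :=
  ⟨hP.congr fun _ _ => not_not⟩

instance IsP1.and (P Q : (Fin n → M.Num) → M.Sets → Prop) [IsP1 P] [IsP1 Q] :
    IsP1 (fun v X => P v X ∧ Q v X) :=
  ⟨IsS1.congr (P := fun v X => ¬ P v X ∨ ¬ Q v X) inferInstance fun _ _ => not_and_or⟩

instance IsP1.or (P Q : (Fin n → M.Num) → M.Sets → Prop) [IsP1 P] [IsP1 Q] :
    IsP1 (fun v X => P v X ∨ Q v X) :=
  ⟨IsS1.congr (P := fun v X => ¬ P v X ∧ ¬ Q v X) inferInstance fun _ _ => not_or⟩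

instance IsP1.imp (P Q : (Fin n → M.Num) → M.Sets → Prop) [IsS1 P] [IsP1 Q] :
    IsP1 (fun v X => P v X → Q v X) :=
  IsP1.congr (P := fun v X => ¬ P v X ∨ Q v X) inferInstance fun _ _ => imp_iff_not_or

instance IsP1.all (P : M.Num → (Fin n → M.Num) → M.Sets → Prop)
    [IsP1 (fun (v : Fin (n + 1) → M.Num) X => P (v (Fin.last n)) (fun i => v i.castSucc) X)] :
    IsP1 (fun v X => ∀ a, P a v X) :=
  ⟨IsS1.congr (P := fun v X => ∃ a, ¬ P a v X) inferInstance fun _ _ => not_forall⟩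

instance IsP1.bex (f : (Fin n → M.Num) → M.Num) (P : M.Num → (Fin n → M.Num) → M.Sets → Prop)
    [IsTm f]
    [IsP1 (fun (v : Fin (n + 1) → M.Num) X => P (v (Fin.last n)) (fun i => v i.castSucc) X)] :
    IsP1 (fun v X => ∃ a, a < f v ∧ P a v X) :=
  ⟨IsS1.congr (P := fun v X => ∀ a, a < f v → ¬ P a v X) inferInstance fun _ _ => by push Not; rfl⟩

instance IsP1.bex_le (f : (Fin n → M.Num) → M.Num) (P : M.Num → (Fin n → M.Num) → M.Sets → Prop)
    [IsTm f]
    [IsP1 (fun (v : Fin (n + 1) → M.Num) X => P (v (Fin.last n)) (fun i => v i.castSucc) X)] :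
    IsP1 (fun v X => ∃ a, a ≤ f v ∧ P a v X) :=
  IsP1.congr (P := fun v X => ∃ a, a < f v + 1 ∧ P a v X) inferInstance fun v X => by
    simp only [lt_add_one_iff]

/-! ### Substitution -/

omit hM in
theorem IsS1.subst {P : (Fin n → M.Num) → M.Sets → Prop} (hP : IsS1 P) {m : ℕ}
    (σ : Fin n → (Fin m → M.Num) → M.Num) (hσ : ∀ i, IsTm (σ i))
    (T : (Fin m → M.Num) → M.Sets → M.Sets)
    (hT : ∀ {m' : ℕ} (τ : (Fin m' → M.Num) → M.Num) (ρ : (Fin m' → M.Num) → Fin m → M.Num),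
      IsTm τ → (∀ i, IsTm (fun v => ρ v i)) → IsD0 (fun v X => τ v ∈ T (ρ v) X)) :
    IsS1 (fun v X => P (fun i => σ i v) (T v X)) := by
  obtain ⟨Q, h1, h2⟩ := hP
  refine ⟨fun b v X => Q b (fun i => σ i v) (T v X), ?_, fun v X => h2 _ _⟩
  have := h1.subst _ (isTm_snoc (fun i (v : Fin (m + 1) → M.Num) => σ i (fun i => v i.castSucc))
    (fun v => v (Fin.last _)) (fun i => (hσ i).weaken) inferInstance)
    (fun v X => T (fun i => v i.castSucc) X) (fun τ ρ hτ hρ => hT τ _ hτ fun i => hρ i.castSucc)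
  simpa only [Fin.snoc_last, Fin.snoc_castSucc] using this

omit hM in
theorem IsP1.subst {P : (Fin n → M.Num) → M.Sets → Prop} (hP : IsP1 P) {m : ℕ}
    (σ : Fin n → (Fin m → M.Num) → M.Num) (hσ : ∀ i, IsTm (σ i))
    (T : (Fin m → M.Num) → M.Sets → M.Sets)
    (hT : ∀ {m' : ℕ} (τ : (Fin m' → M.Num) → M.Num) (ρ : (Fin m' → M.Num) → Fin m → M.Num),
      IsTm τ → (∀ i, IsTm (fun v => ρ v i)) → IsD0 (fun v X => τ v ∈ T (ρ v) X)) :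
    IsP1 (fun v X => P (fun i => σ i v) (T v X)) :=
  ⟨hP.not.subst σ hσ T hT⟩

omit hM in
theorem IsS2.subst {P : (Fin n → M.Num) → M.Sets → Prop} (hP : IsS2 P) {m : ℕ}
    (σ : Fin n → (Fin m → M.Num) → M.Num) (hσ : ∀ i, IsTm (σ i))
    (T : (Fin m → M.Num) → M.Sets → M.Sets)
    (hT : ∀ {m' : ℕ} (τ : (Fin m' → M.Num) → M.Num) (ρ : (Fin m' → M.Num) → Fin m → M.Num),
      IsTm τ → (∀ i, IsTm (fun v => ρ v i)) → IsD0 (fun v X => τ v ∈ T (ρ v) X)) :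
    IsS2 (fun v X => P (fun i => σ i v) (T v X)) := by
  obtain ⟨Q, h1, h2⟩ := hP
  refine ⟨fun b v X => Q b (fun i => σ i v) (T v X), ?_, fun v X => h2 _ _⟩
  have := h1.subst _ (isTm_snoc (fun i (v : Fin (m + 1) → M.Num) => σ i (fun i => v i.castSucc))
    (fun v => v (Fin.last _)) (fun i => (hσ i).weaken) inferInstance)
    (fun v X => T (fun i => v i.castSucc) X) (fun τ ρ hτ hρ => hT τ _ hτ fun i => hρ i.castSucc)
  simpa only [Fin.snoc_last, Fin.snoc_castSucc] using this

omit hM in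
theorem IsP1.comp {P : (Fin n → M.Num) → M.Sets → Prop} (hP : IsP1 P) {m : ℕ}
    (σ : Fin n → (Fin m → M.Num) → M.Num) (hσ : ∀ i, IsTm (σ i)) :
    IsP1 (fun v X => P (fun i => σ i v) X) :=
  hP.subst σ hσ (fun _ X => X) fun _ _ _ _ => inferInstance

/-! ### Closure properties of `Σ⁰₂` -/

instance (priority := 50) IsS2.of_isP1 (P : (Fin n → M.Num) → M.Sets → Prop) [hP : IsP1 P] :
    IsS2 P :=
  ⟨fun _ v X => P v X, hP.comp (fun i v => v i.castSucc) fun _ => inferInstance,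
    fun _ _ => ⟨fun h => ⟨0, h⟩, fun ⟨_, h⟩ => h⟩⟩

instance IsS2.or (P Q : (Fin n → M.Num) → M.Sets → Prop) [hP : IsS2 P] [hQ : IsS2 Q] :
    IsS2 (fun v X => P v X ∨ Q v X) := by
  obtain ⟨A, h1, h2⟩ := hP
  obtain ⟨B, h3, h4⟩ := hQ
  exact ⟨fun b v X => A b v X ∨ B b v X, IsP1.or _ _, fun v X => by rw [h2, h4, exists_or]⟩

omit hM in
theorem IsP1.comp_snoc {Q : M.Num → (Fin n → M.Num) → M.Sets → Prop}
    (hQ : IsP1 (fun (v : Fin (n + 1) → M.Num) X => Q (v (Fin.last n)) (fun i => v i.castSucc) X))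
    {m : ℕ} (τ : (Fin m → M.Num) → M.Num) (hτ : IsTm τ)
    (σ : Fin n → (Fin m → M.Num) → M.Num) (hσ : ∀ i, IsTm (σ i)) :
    IsP1 (fun v X => Q (τ v) (fun i => σ i v) X) := by
  have := hQ.comp _ (isTm_snoc σ τ hσ hτ)
  simpa only [Fin.snoc_last, Fin.snoc_castSucc] using this

/-- As for `Σ⁰₁`, the quantifiers are merged by a common bound. The matrix stays `Π⁰₁` because
`IsP1.bex` absorbs bounded existential quantifiers, which rests on collection. -/
instance IsS2.ex_isS2 (P : M.Num → (Fin n → M.Num) → M.Sets → Prop)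
    [hP : IsS2 (fun (v : Fin (n + 1) → M.Num) X => P (v (Fin.last n)) (fun i => v i.castSucc) X)] :
    IsS2 (fun v X => ∃ a, P a v X) := by
  obtain ⟨A, h1, h2⟩ := hP
  have h3 : ∀ a v X, P a v X ↔ ∃ b, A b (Fin.snoc v a) X := fun a v X => by
    simpa using h2 (Fin.snoc v a) X
  refine ⟨fun c v X => ∃ a < c, ∃ b < c, A b (Fin.snoc v a) X, ?_, fun v X => ?_⟩
  · have : IsP1 fun (w : Fin (n + 3) → M.Num) X => A (w (Fin.last _))
        (Fin.snoc (fun i : Fin n => w i.castSucc.castSucc.castSucc) (w (Fin.last _).castSucc)) X := by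
      refine (h1.comp_snoc (fun w : Fin (n + 3) → M.Num => w (Fin.last _)) inferInstance
        _ (isTm_snoc (fun (i : Fin n) (w : Fin (n + 3) → M.Num) => w i.castSucc.castSucc.castSucc)
          (fun w => w (Fin.last _).castSucc) (fun _ => inferInstance)
          inferInstance)).congr fun w X => ?_
      apply iff_of_eq
      congr 1
      funext i
      induction i using Fin.lastCases <;> simp
    infer_instance
  · simp only [h3]
    exact exists_bounds₂

theorem IsP1.collapse {Q : M.Num → (Fin n → M.Num) → M.Sets → Prop}
    (hQ : IsP1 (fun (v : Fin (n + 1) → M.Num) X => Q (v (Fin.last n)) (fun i => v i.castSucc) X)) :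
    IsP1 (fun (v : Fin (n + 1) → M.Num) X => ∃ c < v (Fin.last n), Q c (fun i => v i.castSucc) X) := by
  have : IsP1 fun (w : Fin (n + 2) → M.Num) X => Q (w (Fin.last _))
      (fun i => w i.castSucc.castSucc) X :=
    hQ.comp_snoc _ inferInstance (fun i w => w i.castSucc.castSucc) fun _ => inferInstance
  infer_instance

instance IsS2.and (P Q : (Fin n → M.Num) → M.Sets → Prop) [hP : IsS2 P] [hQ : IsS2 Q] :
    IsS2 (fun v X => P v X ∧ Q v X) := by
  obtain ⟨A, h1, h2⟩ := hP
  obtain ⟨B, h3, h4⟩ := hQ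
  have := h1.collapse
  have := h3.collapse
  refine ⟨fun c v X => (∃ a < c, A a v X) ∧ ∃ b < c, B b v X, IsP1.and _ _, fun v X => ?_⟩
  rw [h2, h4]
  constructor
  · rintro ⟨⟨a, ha⟩, b, hb⟩
    exact ⟨a + b + 1, ⟨a, lt_add_one_iff.2 le_self_add, ha⟩, b, lt_add_one_iff.2 le_add_self, hb⟩
  · rintro ⟨c, ⟨a, _, ha⟩, b, _, hb⟩
    exact ⟨⟨a, ha⟩, b, hb⟩

/-! ### Passing between formulas and definability -/

omit hM in
theorem IsP1.exists_formula {P : (Fin n → M.Num) → M.Sets → Prop} (hP : IsP1 P) :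
    ∃ φ : Formula M, φ.IsPi01 ∧ ∀ v W, φ.Sat v W ↔ P (fun i => v i) (W 0) := by
  obtain ⟨Q, ⟨θ, h1, h2⟩, h3⟩ := hP.not
  refine ⟨.allNum n (.neg θ), ⟨n, _, .neg h1, rfl⟩, fun v W => ?_⟩
  rw [← not_not (a := P _ _), h3, not_exists]
  refine forall_congr' fun a => not_congr ?_
  rw [h2]
  simp only [Fin.val_last, Function.update_self, Fin.val_castSucc, restrict_update]

omit hM in
theorem IsS2.exists_formula {P : (Fin n → M.Num) → M.Sets → Prop} (hP : IsS2 P) :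
    ∃ φ : Formula M, φ.IsSigma02 ∧ ∀ v W, φ.Sat v W ↔ P (fun i => v i) (W 0) := by
  obtain ⟨Q, hQ, h3⟩ := hP
  obtain ⟨ψ, ⟨k, θ, hθ, rfl⟩, h2⟩ := hQ.exists_formula
  refine ⟨.exNum n (.allNum k θ), ⟨n, k, θ, hθ, rfl⟩, fun v W => ?_⟩
  rw [h3]
  refine exists_congr fun a => ?_
  rw [h2]
  simp only [Fin.val_last, Function.update_self, Fin.val_castSucc, restrict_update]

theorem Formula.IsSigma02.isS2 {φ : Formula M} (hφ : φ.IsSigma02) (v : ℕ → M.Num)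
    (W : ℕ → M.Sets) : IsS2 (fun (w : Fin 1 → M.Num) X => DefRel φ v W X (w 0)) := by
  obtain ⟨m, k, θ, hθ, rfl⟩ := hφ
  -- The indices `0`, `m`, `k` may coincide; nested updates in the order of the quantifiers give the
  -- correct overriding.
  have h := Formula.sat_isD0 hθ
    (fun i (w : Fin 3 → M.Num) =>
      Function.update (Function.update (Function.update v 0 (w 0)) m (w 1)) k (w 2) i)
    (fun i => by
      simp only [Function.update_apply]
      split_ifs <;> infer_instance)
    (fun _ X => Function.update W 0 X) (fun i m' τ ρ hτ _ => by
      by_cases h : i = 0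
      · subst h; simp only [Function.update_self]; infer_instance
      · simp only [Function.update_of_ne h]; infer_instance)
  have h' : IsP1 (fun (w : Fin 2 → M.Num) X => ∀ b, θ.Sat
      (Function.update (Function.update (Function.update v 0 (w 0)) m (w 1)) k b)
      (Function.update W 0 X)) :=
    @IsP1.all _ _ _ (fun b w X => θ.Sat
      (Function.update (Function.update (Function.update v 0 (w 0)) m (w 1)) k b)
      (Function.update W 0 X)) (IsP1.of_isD0 _ (hP := h))
  exact ⟨fun a w X => ∀ b, θ.Sat
      (Function.update (Function.update (Function.update v 0 (w 0)) m a) k b)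
      (Function.update W 0 X), h', fun _ _ => Iff.rfl⟩

/-! ### Comprehension and minimization -/

theorem comprehension (P : M.Num → Prop)
    (hS : IsS1 (fun (v : Fin 1 → M.Num) (_ : M.Sets) => P (v 0)))
    (hP : IsP1 (fun (v : Fin 1 → M.Num) (_ : M.Sets) => P (v 0))) :
    ∃ S : M.Sets, ∀ a, a ∈ S ↔ P a := by
  obtain ⟨φ, h1, h2⟩ := hS.exists_formula
  obtain ⟨ψ, h3, h4⟩ := hP.exists_formula
  obtain ⟨A, hA⟩ := M.sets_nonempty
  have := hM.out.delta01_comprehension φ ψ h1 h3 (fun _ => 0) (fun _ => ⟨A, hA⟩) 0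
  simp only [h2, h4, Fin.val_zero, Function.update_self, implies_true, true_imp_iff] at this
  exact this

theorem comprehension_D0 (P : M.Num → Prop)
    (h : IsD0 (fun (v : Fin 1 → M.Num) (_ : M.Sets) => P (v 0))) :
    ∃ S : M.Sets, ∀ a, a ∈ S ↔ P a :=
  comprehension P inferInstance inferInstance

/-- Without a least element one can step down from `a` arbitrarily often: by `Σ⁰₁`-induction on `y`
some `x` with `P x` satisfies `x + y ≤ a`, which is absurd for `y = a + 1`. -/
theorem exists_least_S1 (P : M.Num → Prop)
    (hP : IsS1 (fun (v : Fin 1 → M.Num) (_ : M.Sets) => P (v 0))) (h : ∃ a, P a) :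
    ∃ a, P a ∧ ∀ b < a, ¬ P b := by
  obtain ⟨a, ha⟩ := h
  have hP' : ∀ {m : ℕ} (f : (Fin m → M.Num) → M.Num) [IsTm f],
      IsS1 (fun v (_ : M.Sets) => P (f v)) := fun f _ =>
    hP.subst ![f] (fun i => by fin_cases i; simpa) (fun _ X => X) fun _ _ _ _ => inferInstance
  by_contra! H
  have := induction_S1 (fun y => ∃ x, x + y ≤ a ∧ P x) inferInstance ⟨a, by simp, ha⟩
    (fun y ⟨x, hx, hPx⟩ => by
      obtain ⟨b, hb, hPb⟩ := H x hPx
      refine ⟨b, le_trans ?_ hx, hPb⟩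
      rw [add_comm y 1, ← add_assoc]
      exact add_le_add_left (add_one_le_iff.2 hb) y) (a + 1)
  obtain ⟨x, hx, _⟩ := this
  exact absurd ((le_add_self.trans hx : a + 1 ≤ a)) (not_le.2 (lt_add_one_iff.2 le_rfl))

theorem exists_least (P : M.Num → Prop)
    (hP : IsD0 (fun (v : Fin 1 → M.Num) (_ : M.Sets) => P (v 0))) (h : ∃ a, P a) :
    ∃ a, P a ∧ ∀ b < a, ¬ P b :=
  exists_least_S1 P inferInstance h

theorem exists_greatest (P : M.Num → Prop)
    (hP : IsD0 (fun (v : Fin 1 → M.Num) (_ : M.Sets) => P (v 0))) {c : M.Num}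
    (h : ∃ a ≤ c, P a) : ∃ a ≤ c, P a ∧ ∀ b ≤ c, P b → b ≤ a := by
  have hP' : ∀ {m : ℕ} (f : (Fin m → M.Num) → M.Num) [IsTm f],
      IsD0 (fun v (_ : M.Sets) => P (f v)) := fun f _ =>
    hP.comp ![f] (fun i => by fin_cases i; simpa)
  -- The greatest `x ≤ c` is the one with minimal difference `d = c - x`.
  obtain ⟨d, ⟨x, hx, hxd, hPx⟩, hd⟩ := exists_least (fun d => ∃ x ≤ c, x + d = c ∧ P x) inferInstance
    (by
      obtain ⟨a, ha, hPa⟩ := h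
      obtain ⟨d, hd⟩ := exists_add_of_le ha
      exact ⟨d, a, ha, hd.symm, hPa⟩)
  refine ⟨x, hx, hPx, fun b hb hPb => ?_⟩
  by_contra! H
  obtain ⟨e, he⟩ := exists_add_of_le hb
  refine hd e ?_ ⟨b, hb, he.symm, hPb⟩
  by_contra! H'
  exact (add_lt_add_of_lt_of_le H H').ne (hxd.trans he)

theorem induction_lt (P : M.Num → Prop)
    (hP : IsD0 (fun (v : Fin 1 → M.Num) (_ : M.Sets) => P (v 0)))
    (step : ∀ n, (∀ m < n, P m) → P n) (n : M.Num) : P n := by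
  by_contra h
  obtain ⟨a, ha, hmin⟩ := exists_least (fun a => ¬ P a) inferInstance ⟨n, h⟩
  exact ha (step a fun m hm => not_not.1 (hmin m hm))

/-! ### Infinite sets -/

omit hM in
theorem sets_ext {X Y : M.Sets} (h : ∀ a, a ∈ X ↔ a ∈ Y) : X = Y :=
  Subtype.ext (Set.ext h)

theorem exists_above (X : M.Sets) (x : M.Num) : ∃ Y : M.Sets, ∀ a, a ∈ Y ↔ a ∈ X ∧ x ≤ a :=
  comprehension_D0 (fun a => a ∈ X ∧ x ≤ a) inferInstance

/-- The final segment of `X` that starts at `x`. -/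
noncomputable def above (X : M.Sets) (x : M.Num) : M.Sets := (exists_above X x).choose

theorem mem_above {X : M.Sets} {x a : M.Num} : a ∈ above X x ↔ a ∈ X ∧ x ≤ a :=
  (exists_above X x).choose_spec a

theorem IsInfinite.above {X : M.Sets} (hX : M.IsInfinite X) (x : M.Num) :
    M.IsInfinite (above X x) := fun n => by
  obtain ⟨m, hm, hmX⟩ := hX (n + x)
  replace hm : n + x < m := hm
  exact ⟨m, lt_of_le_of_lt le_self_add hm, mem_above.2 ⟨hmX, le_add_self.trans hm.le⟩⟩

/-- `y` is the element of `X` that follows `x`. -/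
def IsNext (X : M.Sets) (x y : M.Num) : Prop := y ∈ X ∧ x < y ∧ ∀ z, z < y → z ∈ X → z ≤ x

theorem IsInfinite.exists_next {X : M.Sets} (hX : M.IsInfinite X) (x : M.Num) :
    ∃ y, IsNext X x y := by
  obtain ⟨y, hy, hmin⟩ := exists_least (fun y => x < y ∧ y ∈ X) inferInstance (hX x)
  exact ⟨y, hy.2, hy.1, fun z hz hzX => not_lt.1 fun h => hmin z hz ⟨h, hzX⟩⟩

theorem IsNext.le_of_lt {X : M.Sets} {x y z : M.Num} (h : IsNext X x y) (hz : z ∈ X)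
    (hxz : x < z) : y ≤ z := not_lt.1 fun hzy => (h.2.2 z hzy hz).not_gt hxz

theorem IsNext.unique {X : M.Sets} {x y z : M.Num} (h : IsNext X x y) (h' : IsNext X x z) :
    y = z := le_antisymm (h.le_of_lt h'.1 h'.2.1) (h'.le_of_lt h.1 h.2.1)

theorem IsInfinite.exists_min {X : M.Sets} (hX : M.IsInfinite X) :
    ∃ x, x ∈ X ∧ ∀ a, a ∈ X → x ≤ a := by
  obtain ⟨x, hx, hmin⟩ := exists_least (fun x => x ∈ X) inferInstance ((hX 0).imp fun _ h => h.2)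
  exact ⟨x, hx, fun a ha => not_lt.1 fun h => hmin a h ha⟩

/-- Allows tails to be replaced by final segments `above X y`, which are uniformly bounded-definable
from `X` and `y` and can hence be substituted into formulas. -/
theorem isTail_iff {X Y : M.Sets} {x y : M.Num} (hx : x ∈ X) (hmin : ∀ a, a ∈ X → x ≤ a)
    (h : IsNext X x y) : M.IsTail X Y ↔ Y = L2Structure.above X y := by
  have key : ∀ a, (a ∈ X ∧ a ≠ x) ↔ a ∈ X ∧ y ≤ a := fun a => by
    refine and_congr_right fun ha => ⟨fun hne => ?_, fun hya => (h.2.1.trans_le hya).ne'⟩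
    exact h.le_of_lt ha (lt_of_le_of_ne (hmin a ha) (Ne.symm hne))
  constructor
  · rintro ⟨x', hx', hmin', hY⟩
    obtain rfl : x' = x := le_antisymm (not_lt.1 (hmin' x hx)) (hmin x' hx')
    exact sets_ext fun a => (hY a).trans ((key a).trans mem_above.symm)
  · rintro rfl
    exact ⟨x, hx, fun a ha => not_lt.2 (hmin a ha), fun a => mem_above.trans (key a).symm⟩

end model
end L2Structure

namespace L2Structure

variable {M : L2Structure.{u}} {n : ℕ}

section model

variable [hM : Fact M.IsModelRCA0]

/-! ### Coding of bounded sets and primitive recursion -/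

/-- Membership of `i` in the finite set with Gödel code `(u, w)`. -/
def InCode (u w i : M.Num) : Prop := 1 + (i + 1) * w ∣ u

instance IsD0.inCode (f g h : (Fin n → M.Num) → M.Num) [IsTm f] [IsTm g] [IsTm h] :
    IsD0 (fun v _ => InCode (f v) (g v) (h v)) :=
  IsD0.dvd (fun v => 1 + (h v + 1) * g v) f

theorem dvd_of_dvd_add {d x y : M.Num} (hx : d ∣ x) (h : d ∣ x + y) : d ∣ y := by
  obtain ⟨e, rfl⟩ := hx
  obtain ⟨f, hf⟩ := h
  rcases eq_or_ne d 0 with rfl | hd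
  · simp only [zero_mul, zero_add] at hf
    simp [hf]
  · have : e ≤ f := le_of_mul_le_mul_left (hf ▸ le_self_add) (pos_iff_ne_zero.2 hd)
    obtain ⟨g, rfl⟩ := exists_add_of_le this
    rw [mul_add] at hf
    exact ⟨g, add_left_cancel hf⟩

/-- The modulus `1 + (i + 1) * w` is coprime to `w` and thus to its divisor `d`, so both factors can
be cancelled. The cancellation is carried out with explicit multiples. -/
theorem InCode.of_dvd {u w i d : M.Num} (hd : d ∣ w) (h : 1 + (i + 1) * w ∣ u * (d * w)) :
    InCode u w i := by
  obtain ⟨k, rfl⟩ := hd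
  set w := d * k with hw
  have h1 : 1 + (i + 1) * w ∣ (i + 1) * (u * w * w) := by
    have := h.mul_left ((i + 1) * k)
    rwa [show (i + 1) * k * (u * (d * w)) = (i + 1) * (u * w * w) by rw [hw]; ring] at this
  have h2 : 1 + (i + 1) * w ∣ u * w := by
    refine dvd_of_dvd_add h1 ⟨u * w, ?_⟩
    ring
  refine dvd_of_dvd_add (h2.mul_left (i + 1)) ⟨u, ?_⟩
  ring

/-- Gödel's argument: the moduli for `i` and `j` differ by a multiple `d * w` with `d < b`, and `d`
divides `w`, so they are coprime. Multiplication of `u` by the modulus for `j` therefore affects no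
other membership below `b`. -/
theorem inCode_mul_iff {u w i j b : M.Num} (hi : i < b) (hj : j < b) (hij : i ≠ j)
    (hw : ∀ d < b, 0 < d → d ∣ w) : InCode (u * (1 + (j + 1) * w)) w i ↔ InCode u w i := by
  refine ⟨fun h => ?_, fun h => h.mul_right _⟩
  rcases hij.lt_or_gt with hlt | hlt
  · obtain ⟨d, rfl⟩ := exists_add_of_le hlt.le
    refine InCode.of_dvd (hw d (le_add_self.trans_lt hj) (by simpa using hlt)) ?_
    refine dvd_of_dvd_add (x := u * (1 + (i + 1) * w)) (dvd_mul_left _ _) ?_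
    rw [show u * (1 + (i + 1) * w) + u * (d * w) = u * (1 + (i + d + 1) * w) by ring]
    exact h
  · obtain ⟨d, rfl⟩ := exists_add_of_le hlt.le
    refine InCode.of_dvd (hw d (le_add_self.trans_lt hi) (by simpa using hlt)) ?_
    refine dvd_of_dvd_add h ⟨u, ?_⟩
    ring

theorem exists_common_multiple (b : M.Num) : ∃ w : M.Num, 0 < w ∧ ∀ d < b, 0 < d → d ∣ w := by
  refine induction_S1 (fun b => ∃ w : M.Num, 0 < w ∧ ∀ d < b, 0 < d → d ∣ w) inferInstance
    ⟨1, zero_lt_one, fun d hd => (not_lt_zero hd).elim⟩ (fun b ⟨w, hw, h⟩ => ?_) b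
  rcases eq_or_ne b 0 with rfl | hb
  · refine ⟨1, zero_lt_one, fun d hd hd' => ?_⟩
    exact absurd (lt_add_one_iff.1 hd) (not_le.2 hd')
  · refine ⟨w * b, mul_pos hw (pos_iff_ne_zero.2 hb), fun d hd hd' => ?_⟩
    rcases (lt_add_one_iff.1 hd).lt_or_eq with hd | rfl
    · exact (h d hd hd').mul_right _
    · exact dvd_mul_left _ _

/-- The number `u` is the product of the moduli for the elements of `S` below `b`. -/
theorem exists_code (S : M.Sets) (b : M.Num) : ∃ u w, ∀ i < b, (InCode u w i ↔ i ∈ S) := by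
  obtain ⟨w, hw, hd⟩ := exists_common_multiple b
  suffices H : ∃ u, ∀ i < b, (InCode u w i ↔ i < b ∧ i ∈ S) by
    obtain ⟨u, hu⟩ := H
    exact ⟨u, w, fun i hi => (hu i hi).trans (and_iff_right hi)⟩
  refine induction_S1 (fun k => ∃ u, ∀ i < b, (InCode u w i ↔ i < k ∧ i ∈ S)) inferInstance
    ⟨1, fun i _ => ⟨?_, fun h => (not_lt_zero h.1).elim⟩⟩ (fun k ⟨u, hu⟩ => ?_) b
  -- The empty set has code `u = 1`: since `w > 0`, no modulus divides `1`.
  · rintro ⟨c, hc⟩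
    have hc0 : c ≠ 0 := by rintro rfl; simp at hc
    have h1 : 1 + (i + 1) * w ≤ 1 := (le_mul_right_of_ne_zero hc0).trans hc.ge
    have h2 : 0 < (i + 1) * w := mul_pos (lt_add_one_iff.2 zero_le) hw
    exact absurd h1 (not_le.2 (lt_add_of_pos_right 1 h2))
  · by_cases hk : k < b ∧ k ∈ S
    · refine ⟨u * (1 + (k + 1) * w), fun i hi => ?_⟩
      by_cases hik : i = k
      · subst hik
        exact iff_of_true (dvd_mul_left _ _) ⟨lt_add_one_iff.2 le_rfl, hk.2⟩
      · rw [inCode_mul_iff hi hk.1 hik hd, hu i hi, lt_add_one_iff, le_iff_lt_or_eq,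
          or_iff_left hik]
    · refine ⟨u, fun i hi => ?_⟩
      rw [hu i hi, lt_add_one_iff, le_iff_lt_or_eq]
      constructor
      · exact fun h => ⟨.inl h.1, h.2⟩
      · rintro ⟨h | rfl, h'⟩
        exacts [⟨h, h'⟩, (hk ⟨hi, h'⟩).elim]

/-- The graph of `f` is `Σ⁰₁` via codes of finite computations. As values exist and are unique, it
is also `Π⁰₁`, hence a set. -/
theorem exists_primrec (a₀ : M.Num) (g : M.Num → M.Num → M.Num)
    (hg : IsD0 (fun (v : Fin 3 → M.Num) (_ : M.Sets) => g (v 0) (v 1) = v 2)) :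
    ∃ (f : M.Num → M.Num) (S : M.Sets), (∀ k a, M.pair k a ∈ S ↔ f k = a) ∧ f 0 = a₀ ∧
      ∀ k, f (k + 1) = g k (f k) := by
  have hg' : ∀ {m : ℕ} (p q r : (Fin m → M.Num) → M.Num) [IsTm p] [IsTm q] [IsTm r],
      IsD0 (fun v (_ : M.Sets) => g (p v) (q v) = r v) := fun p q r _ _ _ =>
    hg.comp ![p, q, r] (fun i => by fin_cases i <;> simpa)
  -- Every coded pair up to `B` must be justified, either as the initial pair or by a coded
  -- predecessor. The code is ignored beyond `B`.
  let Tr (u w B : M.Num) : Prop := ∀ j ≤ B, ∀ y ≤ B, M.pair j y ≤ B → InCode u w (M.pair j y) →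
    (j = 0 ∧ y = a₀) ∨ ∃ j' ≤ B, ∃ y' ≤ B, j = j' + 1 ∧ M.pair j' y' ≤ B ∧
      InCode u w (M.pair j' y') ∧ g j' y' = y
  let V (k a : M.Num) : Prop := ∃ u w B, Tr u w B ∧ M.pair k a ≤ B ∧ InCode u w (M.pair k a)
  have hV : ∀ {m : ℕ} (p q : (Fin m → M.Num) → M.Num) [IsTm p] [IsTm q],
      IsS1 (fun v (_ : M.Sets) => V (p v) (q v)) := fun {m} p q _ _ => by
    have : IsS1 (fun (v : Fin 2 → M.Num) (_ : M.Sets) => V (v 0) (v 1)) := by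
      simp only [V, Tr]
      infer_instance
    exact this.subst ![p, q] (fun i => by fin_cases i <;> simpa) (fun _ X => X)
      fun _ _ _ _ => inferInstance
  -- To add an element `c`, a completely new code is taken, since `w` may be unsuitable for the
  -- larger bound.
  have hext : ∀ u w B c : M.Num, ∃ u' w' B' : M.Num, ∀ d, (d ≤ B' ∧ InCode u' w' d) ↔
      (d ≤ B ∧ InCode u w d) ∨ d = c := by
    intro u w B c
    obtain ⟨S, hS⟩ := comprehension_D0 (fun d => (d ≤ B ∧ InCode u w d) ∨ d = c) inferInstance
    obtain ⟨u', w', h⟩ := exists_code S (B + c + 1)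
    refine ⟨u', w', B + c, fun d => ?_⟩
    constructor
    · exact fun hd => (hS d).1 ((h d (lt_add_one_iff.2 hd.1)).1 hd.2)
    · intro hd
      have : d ≤ B + c := by
        rcases hd with hd | rfl
        exacts [hd.1.trans le_self_add, le_add_self]
      exact ⟨this, (h d (lt_add_one_iff.2 this)).2 ((hS d).2 hd)⟩
  have huniq : ∀ k a a', V k a → V k a' → a = a' := by
    rintro k a a' ⟨u, w, B, h1, h2, h3⟩ ⟨u', w', B', h1', h2', h3'⟩
    have := induction_D0 (fun j => ∀ y ≤ B, ∀ y' ≤ B', M.pair j y ≤ B → M.pair j y' ≤ B' →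
      InCode u w (M.pair j y) → InCode u' w' (M.pair j y') → y = y') inferInstance ?_ ?_ k
    · exact this a ((right_le_pair _ _).trans h2) a' ((right_le_pair _ _).trans h2') h2 h2' h3 h3'
    · intro y hy y' hy' hp hp' hc hc'
      rcases h1 0 zero_le y hy hp hc with ⟨_, rfl⟩ | ⟨j, _, _, _, hj, _⟩
      · rcases h1' 0 zero_le y' hy' hp' hc' with ⟨_, rfl⟩ | ⟨j, _, _, _, hj, _⟩
        · rfl
        · exact (L2Structure.succ_ne_zero' j hj.symm).elim
      · exact (L2Structure.succ_ne_zero' j hj.symm).elim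
    · intro j ih y hy y' hy' hp hp' hc hc'
      rcases h1 _ ((left_le_pair _ _).trans hp) y hy hp hc with
        ⟨hj, _⟩ | ⟨i, _, z, hz, hj, hpz, hcz, rfl⟩
      · exact (L2Structure.succ_ne_zero' j hj).elim
      rcases h1' _ ((left_le_pair _ _).trans hp') y' hy' hp' hc' with
        ⟨hj', _⟩ | ⟨i', _, z', hz', hj', hpz', hcz', rfl⟩
      · exact (L2Structure.succ_ne_zero' j hj').elim
      obtain rfl := L2Structure.succ_inj' hj
      obtain rfl := L2Structure.succ_inj' hj'
      rw [ih z hz z' hz' hpz hpz' hcz hcz']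
  have hzero : V 0 a₀ := by
    obtain ⟨S, hS⟩ := comprehension_D0 (fun d => d = M.pair 0 a₀) inferInstance
    obtain ⟨u, w, h⟩ := exists_code S (M.pair 0 a₀ + 1)
    refine ⟨u, w, M.pair 0 a₀, fun j _ y _ hp hc => .inl ?_, le_rfl,
      (h _ (lt_add_one_iff.2 le_rfl)).2 ((hS _).2 rfl)⟩
    exact pair_inj.1 ((hS _).1 ((h _ (lt_add_one_iff.2 hp)).1 hc))
  have hsucc : ∀ k a, V k a → V (k + 1) (g k a) := by
    rintro k a ⟨u, w, B, h1, h2, h3⟩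
    obtain ⟨u', w', B', h⟩ := hext u w B (M.pair (k + 1) (g k a))
    refine ⟨u', w', B', fun j _ y _ hp hc => ?_, (h _).2 (.inr rfl)⟩
    have hlift : ∀ j' y', M.pair j' y' ≤ B → InCode u w (M.pair j' y') → j' ≤ B' ∧ y' ≤ B' ∧
        M.pair j' y' ≤ B' ∧ InCode u' w' (M.pair j' y') := fun j' y' hp' hc' => by
      obtain ⟨h5, h6⟩ := (h (M.pair j' y')).2 (.inl ⟨hp', hc'⟩)
      exact ⟨(left_le_pair _ _).trans h5, (right_le_pair _ _).trans h5, h5, h6⟩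
    rcases (h _).1 ⟨hp, hc⟩ with ⟨hp', hc'⟩ | heq
    · rcases h1 j ((left_le_pair _ _).trans hp') y ((right_le_pair _ _).trans hp') hp' hc' with
        h0 | ⟨j', _, y', _, hj, hpz, hcz, hgy⟩
      · exact .inl h0
      · obtain ⟨h5, h6, h7, h8⟩ := hlift j' y' hpz hcz
        exact .inr ⟨j', h5, y', h6, hj, h7, h8, hgy⟩
    · obtain ⟨rfl, rfl⟩ := pair_inj.1 heq
      obtain ⟨h5, h6, h7, h8⟩ := hlift k a h2 h3
      exact .inr ⟨k, h5, a, h6, rfl, h7, h8, rfl⟩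
  have hex : ∀ k, ∃ a, V k a := induction_S1 (fun k => ∃ a, V k a) inferInstance ⟨_, hzero⟩
    fun k ⟨a, ha⟩ => ⟨_, hsucc k a ha⟩
  choose f hf using hex
  have hfV : ∀ k a, f k = a ↔ V k a := fun k a =>
    ⟨by rintro rfl; exact hf k, fun h => huniq k _ _ (hf k) h⟩
  obtain ⟨S, hS⟩ := comprehension (fun c => ∃ k ≤ c, ∃ a ≤ c, c = M.pair k a ∧ V k a)
    inferInstance (by
      -- By uniqueness of values, `V k a` amounts to: every `a'` with `V k a'` equals `a`.
      refine IsP1.congr (P := fun (v : Fin 1 → M.Num) _ => ∃ k ≤ v 0, ∃ a ≤ v 0, v 0 = M.pair k a ∧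
        ∀ a', V k a' → a' = a) inferInstance fun v _ => ?_
      simp only [← hfV, forall_eq']
    )
  refine ⟨f, S, fun k a => ?_, (hfV _ _).2 hzero, fun k => (hfV _ _).2 (hsucc k _ (hf k))⟩
  rw [hS, hfV]
  constructor
  · rintro ⟨k', _, a', _, heq, h⟩
    obtain ⟨rfl, rfl⟩ := pair_inj.1 heq
    exact h
  · exact fun h => ⟨k, left_le_pair _ _, a, right_le_pair _ _, rfl, h⟩

instance IsD0.isNext (A : M.Sets) (f g : (Fin n → M.Num) → M.Num) [hf : IsTm f] [hg : IsTm g] :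
    IsD0 (fun v _ => IsNext A (f v) (g v)) :=
  have := hf.weaken
  inferInstanceAs (IsD0 fun v _ => g v ∈ A ∧ f v < g v ∧ ∀ z, z < g v → z ∈ A → z ≤ f v)

/-- Every infinite set is enumerated in increasing order by a function of the model. -/
theorem IsInfinite.exists_enum {X : M.Sets} (hX : M.IsInfinite X) :
    ∃ (e : M.Num → M.Num) (S : M.Sets), (∀ k a, M.pair k a ∈ S ↔ e k = a) ∧
      (∀ k, e k ∈ X) ∧ ∀ k, IsNext X (e k) (e (k + 1)) := by
  choose g hg using fun x => hX.exists_next x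
  obtain ⟨x, hx, _⟩ := hX.exists_min
  obtain ⟨e, S, h1, h2, h3⟩ := exists_primrec x (fun _ a => g a)
    (IsD0.congr (P := fun (v : Fin 3 → M.Num) _ => IsNext X (v 1) (v 2)) inferInstance fun v _ =>
      ⟨fun h => h ▸ hg _, fun h => (hg _).unique h⟩)
  have h4 : ∀ k, IsNext X (e k) (e (k + 1)) := fun k => h3 k ▸ hg _
  refine ⟨e, S, h1, ?_, h4⟩
  have : ∀ k, M.pair k (e k) ∈ S := fun k => (h1 _ _).2 rfl
  -- Membership of `e k` is expressed via the graph `S`, which makes it `Σ⁰₁`.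
  refine fun k => induction_S1 (fun k => ∃ a, M.pair k a ∈ S ∧ a ∈ X) inferInstance ⟨x, ?_, hx⟩
    (fun k _ => ⟨e (k + 1), this _, (h4 k).1⟩) k |>.elim fun a ha => (h1 _ _).1 ha.1 ▸ ha.2
  rw [h1, h2]

/-- Every set can be split so that consecutive elements lie in different parts. -/
theorem exists_alternating (X : M.Sets) :
    ∃ E : M.Sets, ∀ x y, x ∈ X → IsNext X x y → (x ∈ E ↔ ¬ y ∈ E) := by
  classical
  -- The value `f k` is the parity of the number of elements of `X` below `k`.
  obtain ⟨f, S, h1, -, h3⟩ := exists_primrec (M := M) 0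
    (fun k a => if k ∈ X then (if a = 0 then 1 else 0) else a)
    (IsD0.congr (P := fun (v : Fin 3 → M.Num) _ => (v 0 ∈ X ∧ v 1 = 0 ∧ v 2 = 1) ∨ (v 0 ∈ X ∧ ¬ v 1 = 0 ∧ v 2 = 0) ∨
      (¬ v 0 ∈ X ∧ v 1 = v 2)) inferInstance fun v _ => by
        by_cases h : v 0 ∈ X <;> by_cases h' : v 1 = 0 <;> simp [h, h', eq_comm])
  obtain ⟨E, hE⟩ := comprehension_D0 (fun k => M.pair k 0 ∈ S) inferInstance
  refine ⟨E, fun x y hx hxy => ?_⟩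
  -- The parity switches right after `x` and then stays constant up to `y`, as `X` has no elements
  -- in between.
  have key := induction_D0 (fun z => x < z → z ≤ y → (M.pair z 0 ∈ S ↔ ¬ M.pair x 0 ∈ S))
    inferInstance (fun h => (not_lt_zero h).elim) (fun z ih hxz hzy => ?_) y hxy.2.1 le_rfl
  · simp only [hE, key, not_not]
  · simp only [h1] at ih ⊢
    rcases (lt_add_one_iff.1 hxz).lt_or_eq with h | rfl
    · rw [h3, if_neg, ih h ((lt_add_one_iff.2 le_rfl).le.trans hzy)]
      exact fun hz => (hxy.2.2 z (add_one_le_iff.1 hzy) hz).not_gt h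
    · rw [h3, if_pos hx]
      split_ifs with h <;> simp [h]

end model
end L2Structure

namespace L2Structure

variable {M : L2Structure.{u}} {n : ℕ}

section model

variable [hM : Fact M.IsModelRCA0]

/-! ### Colourings of infinite sets with two colours -/

instance IsD0.isNext_var (f g : (Fin n → M.Num) → M.Num) [hf : IsTm f] [hg : IsTm g] :
    IsD0 (fun v X => IsNext X (f v) (g v)) :=
  have := hf.weaken
  inferInstanceAs (IsD0 fun v X => g v ∈ X ∧ f v < g v ∧ ∀ z, z < g v → z ∈ X → z ≤ f v)

theorem isNext_above {X : M.Sets} {a x y : M.Num} (hx : a ≤ x) :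
    IsNext (above X a) x y ↔ IsNext X x y := by
  constructor
  · rintro ⟨h1, h2, h3⟩
    refine ⟨(mem_above.1 h1).1, h2, fun z hz hzX => ?_⟩
    by_contra! h
    exact (h3 z hz (mem_above.2 ⟨hzX, hx.trans h.le⟩)).not_gt h
  · rintro ⟨h1, h2, h3⟩
    exact ⟨mem_above.2 ⟨h1, hx.trans h2.le⟩, h2, fun z hz hzX => h3 z hz (mem_above.1 hzX).1⟩

theorem above_above {X : M.Sets} {a b : M.Num} (h : a ≤ b) : above (above X a) b = above X b :=
  sets_ext fun c => by
    simp only [mem_above, and_assoc, and_congr_right_iff, and_iff_right_iff_imp]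
    exact fun _ hc => h.trans hc

theorem IsInfinite.exists_prev {X : M.Sets} {x z : M.Num} (hx : x ∈ X) (hz : z ∈ X) (h : x < z) :
    ∃ y ∈ X, x ≤ y ∧ IsNext X y z := by
  obtain ⟨y, hyz, ⟨hy, hlt⟩, hmax⟩ := exists_greatest (fun t => t ∈ X ∧ t < z) inferInstance
    ⟨x, h.le, hx, h⟩
  exact ⟨y, hy, hmax x h.le ⟨hx, h⟩, hz, hlt, fun t ht htX => hmax t ht.le ⟨htX, ht⟩⟩

/-- The colour class with index `i`, where `E i x m X` says that `m` witnesses colour `i` for the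
final segment of `X` that starts at `x`. -/
def Col (E : Bool → M.Num → M.Num → M.Sets → Prop) (i : Bool) (x : M.Num) (X : M.Sets) : Prop :=
  ∃ m, E i x m X

/-- A `Σ⁰₂`-colouring of the infinite sets with two colours. -/
structure IsColouring (E : Bool → M.Num → M.Num → M.Sets → Prop) : Prop where
  isP1 : ∀ i, IsP1 (fun (v : Fin 2 → M.Num) X => E i (v 0) (v 1) X)
  above : ∀ i X a x, M.IsInfinite X → x ∈ X → a ≤ x → (Col E i x (above X a) ↔ Col E i x X)
  -- An instance of collection for `Π⁰₁`-properties, which need not be available in `M` and is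
  -- therefore required of the colouring.
  bound : ∀ X, M.IsInfinite X → ∀ n, ∃ b, ∀ x < n, x ∈ X → ∃ i, ∃ m < b, E i x m X
  excl : ∀ X, M.IsInfinite X → ∀ x ∈ X, ∀ i, Col E i x X → ¬ Col E (!i) x X

/-- The code `(u, w)` splits the elements of `X` up to `y` such that consecutive elements lie in
different parts. -/
def AltCode (X : M.Sets) (y u w : M.Num) : Prop :=
  ∀ s, s ≤ y → ∀ t, t ≤ y → s ∈ X → IsNext X s t → (InCode u w s ↔ ¬ InCode u w t)

/-- The colour changes from `i` for the first time after the element `y` of `X`, and the Boolean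
value `p` expresses that the distance between the minimal element `x` and `y` is even. -/
def FirstChange (E : Bool → M.Num → M.Num → M.Sets → Prop) (i p : Bool) (X : M.Sets)
    (x y z u w : M.Num) : Prop :=
  x ∈ X ∧ (∀ a, a < x → ¬ a ∈ X) ∧ y ∈ X ∧ IsNext X y z ∧ Col E (!i) z X ∧ AltCode X y u w ∧
    ((InCode u w x ↔ InCode u w y) ↔ p = true)

/-- The bound `b` on the witnesses keeps the condition on all `s ≤ y` at level `Π⁰₁`. Without it
there would be a bounded universal quantifier in front of a `Σ⁰₂`-property. -/
def Wit (E : Bool → M.Num → M.Num → M.Sets → Prop) (i p : Bool) (X : M.Sets) : Prop :=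
  ∃ x y z u w b, FirstChange E i p X x y z u w ∧ ∀ s, s ≤ y → s ∈ X → ∃ m, m < b ∧ E i s m X

/-- The parity of the distance does not depend on the alternating code: along `X`, each step to the
next element flips both sides. -/
theorem AltCode.iff {X : M.Sets} {x y u w u' w' : M.Num}
    (h : AltCode X y u w) (h' : AltCode X y u' w') (hx : x ∈ X) (hxy : x ≤ y) (hy : y ∈ X) :
    (InCode u w x ↔ InCode u w y) ↔ (InCode u' w' x ↔ InCode u' w' y) := by
  refine induction_lt (fun t => x ≤ t → t ≤ y → t ∈ X → ((InCode u w x ↔ InCode u w t) ↔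
    (InCode u' w' x ↔ InCode u' w' t))) inferInstance (fun t ih hxt hty ht => ?_) y hxy le_rfl hy
  rcases hxt.eq_or_lt with rfl | hlt
  · simp
  · obtain ⟨s, hs, hxs, hst⟩ := IsInfinite.exists_prev hx ht hlt
    have h1 := ih s hst.2.1 hxs (hst.2.1.le.trans hty) hs
    have h2 := h s (hst.2.1.le.trans hty) t hty hs hst
    have h3 := h' s (hst.2.1.le.trans hty) t hty hs hst
    tauto

/-! ### From colourings without homogeneous sets to bad maps into `𝟑` -/

namespace IsColouring

variable {E : Bool → M.Num → M.Num → M.Sets → Prop} (hE : IsColouring E)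
include hE

theorem isP1' (i : Bool) {m : ℕ} (f g : (Fin m → M.Num) → M.Num) [IsTm f] [IsTm g] :
    IsP1 (fun v X => E i (f v) (g v) X) :=
  (hE.isP1 i).comp ![f, g] (fun i => by fin_cases i <;> simpa)

theorem isP1_param (i : Bool) {m : ℕ} (f g : (Fin m → M.Num) → M.Num) [IsTm f] [IsTm g]
    (X : M.Sets) : IsP1 (fun v _ => E i (f v) (g v) X) :=
  (hE.isP1 i).subst ![f, g] (fun i => by fin_cases i <;> simpa) (fun _ _ => X)
    fun _ _ _ _ => inferInstance

set_option synthInstance.maxSize 1000 in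
set_option synthInstance.maxHeartbeats 200000 in
theorem isS2_wit (i p : Bool) : IsS2 (fun (_ : Fin n → M.Num) X => Wit E i p X) := by
  have h1 := fun j {m : ℕ} (f g : (Fin m → M.Num) → M.Num) [IsTm f] [IsTm g] => hE.isP1' j f g
  have : ∀ {m : ℕ} (q : Prop), IsD0 (fun (_ : Fin m → M.Num) (_ : M.Sets) => q) := fun q => by
    by_cases hq : q
    · exact IsD0.congr (P := fun _ _ => (0 : M.Num) = 0) inferInstance (by simp [hq])
    · exact IsD0.congr (P := fun _ _ => ¬ (0 : M.Num) = 0) inferInstance (by simp [hq])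
  simp only [Wit, FirstChange, AltCode, Col]
  infer_instance

theorem total {X : M.Sets} (hX : M.IsInfinite X) {x : M.Num} (hx : x ∈ X) : ∃ i, Col E i x X := by
  obtain ⟨b, hb⟩ := hE.bound X hX (x + 1)
  obtain ⟨i, m, _, h⟩ := hb x (lt_add_one_iff.2 le_rfl) hx
  exact ⟨i, m, h⟩

theorem col_unique {X : M.Sets} (hX : M.IsInfinite X) {x : M.Num} (hx : x ∈ X) {i j : Bool}
    (hi : Col E i x X) (hj : Col E j x X) : i = j := by
  by_contra h
  exact hE.excl X hX x hx i hi ((by rwa [Bool.not_eq.2 h]))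

theorem wit_iff {X : M.Sets} (hX : M.IsInfinite X) {i p : Bool} :
    Wit E i p X ↔ ∃ x y z u w, FirstChange E i p X x y z u w ∧ ∀ s ≤ y, s ∈ X → Col E i s X := by
  constructor
  · rintro ⟨x, y, z, u, w, b, h1, h2⟩
    exact ⟨x, y, z, u, w, h1, fun s hs hsX => (h2 s hs hsX).imp fun _ h => h.2⟩
  · rintro ⟨x, y, z, u, w, h1, h2⟩
    obtain ⟨b, hb⟩ := hE.bound X hX (y + 1)
    refine ⟨x, y, z, u, w, b, h1, fun s hs hsX => ?_⟩
    obtain ⟨j, m, hm, h⟩ := hb s (lt_add_one_iff.2 hs) hsX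
    obtain rfl := hE.col_unique hX hsX ⟨m, h⟩ (h2 s hs hsX)
    exact ⟨m, hm, h⟩

/-- With bounded witnesses both colours are `Π⁰₁` below `c`, and they are complementary, so
`Δ⁰₁`-comprehension applies. -/
theorem exists_colourClass {X : M.Sets} (hX : M.IsInfinite X) (i : Bool) (c : M.Num) :
    ∃ S : M.Sets, ∀ x, x ∈ S ↔ x ∈ X ∧ x < c ∧ Col E i x X := by
  obtain ⟨b, hb⟩ := hE.bound X hX c
  have h1 := fun j {m : ℕ} (f g : (Fin m → M.Num) → M.Num) [IsTm f] [IsTm g] =>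
    hE.isP1_param j f g X
  have key : ∀ j, ∀ x < c, x ∈ X → ((∃ m < b, E j x m X) ↔ Col E j x X) := fun j x hx hxX => by
    refine ⟨fun ⟨m, _, hm⟩ => ⟨m, hm⟩, fun h => ?_⟩
    obtain ⟨k, m, hm, hk⟩ := hb x hx hxX
    obtain rfl := hE.col_unique hX hxX ⟨m, hk⟩ h
    exact ⟨m, hm, hk⟩
  obtain ⟨S, hS⟩ := comprehension (fun x => x ∈ X ∧ x < c ∧ ∃ m < b, E i x m X)
    (IsS1.congr (P := fun (v : Fin 1 → M.Num) _ => v 0 ∈ X ∧ v 0 < c ∧ ¬ ∃ m < b, E (!i) (v 0) m X)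
      inferInstance fun v _ => by
        refine and_congr_right fun hX' => and_congr_right fun hc => ?_
        rw [key _ _ hc hX', key _ _ hc hX']
        refine ⟨hE.excl X hX _ hX' i, fun h => ?_⟩
        obtain ⟨j, hj⟩ := hE.total hX hX'
        by_cases hij : j = i
        · exact hij ▸ hj
        · exact (h (Bool.eq_not.2 hij ▸ hj)).elim)
    inferInstance
  refine ⟨S, fun x => (hS x).trans ?_⟩
  exact and_congr_right fun h => and_congr_right fun h' => key i x h' h

/-- The first change of colour is found by minimization in a finite part of the colour class of
`!i`; `z` is its least element and `y` the predecessor of `z` in `X`. -/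
theorem wit_exists {X : M.Sets} (hX : M.IsInfinite X)
    (hhom : ∀ i, ∃ x ∈ X, ¬ Col E i x X) : ∃ i p, Wit E i p X := by
  classical
  obtain ⟨x, hx, hmin⟩ := hX.exists_min
  obtain ⟨i, hi⟩ := hE.total hX hx
  obtain ⟨a, ha, hai⟩ := hhom i
  have hnot : ∀ s ∈ X, ¬ Col E i s X → Col E (!i) s X := fun s hs h => by
    obtain ⟨j, hj⟩ := hE.total hX hs
    rwa [← Bool.eq_not.2 (show j ≠ i by rintro rfl; exact h hj)]
  obtain ⟨S, hS⟩ := hE.exists_colourClass hX (!i) (a + 1)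
  obtain ⟨z, hz, hzmin⟩ := exists_least (fun s => s ∈ S) inferInstance
    ⟨a, (hS a).2 ⟨ha, lt_add_one_iff.2 le_rfl, hnot a ha hai⟩⟩
  obtain ⟨hzX, hza, hzi⟩ := (hS z).1 hz
  have hxz : x < z := lt_of_le_of_ne (hmin z hzX) (by
    rintro rfl
    exact hE.excl X hX x hx i hi hzi)
  obtain ⟨y, hy, hxy, hyz⟩ := IsInfinite.exists_prev hx hzX hxz
  obtain ⟨A, hA⟩ := exists_alternating X
  obtain ⟨u, w, hu⟩ := exists_code A (y + 1)
  refine ⟨i, decide (InCode u w x ↔ InCode u w y), (hE.wit_iff hX).2 ⟨x, y, z, u, w,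
    ⟨hx, fun b hb hbX => (hmin b hbX).not_gt hb, hy, hyz, hzi, fun s hs t ht hsX hst => ?_,
      by simp⟩, fun s hs hsX => ?_⟩⟩
  · rw [hu s (lt_add_one_iff.2 hs), hu t (lt_add_one_iff.2 ht)]
    exact hA s t hsX hst
  · by_contra h
    have hsz := hs.trans_lt hyz.2.1
    exact hzmin s hsz ((hS s).2 ⟨hsX, hsz.trans hza, hnot s hsX h⟩)

theorem wit_unique {X : M.Sets} (hX : M.IsInfinite X) {i p j q : Bool} (h : Wit E i p X)
    (h' : Wit E j q X) : i = j ∧ p = q := by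
  obtain ⟨x, y, z, u, w, ⟨hx, hmin, hy, hyz, hz, ha, hp⟩, hc⟩ := (hE.wit_iff hX).1 h
  obtain ⟨x', y', z', u', w', ⟨hx', hmin', hy', hyz', hz', ha', hq⟩, hc'⟩ := (hE.wit_iff hX).1 h'
  obtain rfl : x = x' := le_antisymm (not_lt.1 fun h => hmin _ h hx') (not_lt.1 fun h => hmin' _ h hx)
  have hle : ∀ {t}, t ∈ X → x ≤ t := fun ht => not_lt.1 fun h => hmin _ h ht
  obtain rfl := hE.col_unique hX hx (hc x (hle hy) hx) (hc' x (hle hy') hx)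
  have key : ∀ {y z y'}, IsNext X y z → Col E (!i) z X → y' ∈ X →
      (∀ s ≤ y', s ∈ X → Col E i s X) → y' ≤ y := fun h1 h2 h3 h4 => not_lt.1 fun h =>
    hE.excl X hX _ h1.1 i (h4 _ (h1.le_of_lt h3 h) h1.1) h2
  obtain rfl : y = y' := le_antisymm (key hyz' hz' hy hc) (key hyz hz hy' hc')
  refine ⟨rfl, Bool.eq_iff_iff.2 ?_⟩
  rw [← hp, ← hq]
  exact ha.iff ha' hx (hle hy) hy

/-- If the change occurs right after the minimum, the tail starts with the other colour. Otherwise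
the tail has the same first change, and its minimum is one step closer to it. -/
theorem wit_tail {X : M.Sets} (hX : M.IsInfinite X) {x x' : M.Num} (hx : x ∈ X)
    (hmin : ∀ a, a ∈ X → x ≤ a) (hxx' : IsNext X x x') {i p : Bool} (h : Wit E i p X) :
    (p = true ∧ ∀ j q, Wit E j q (L2Structure.above X x') → j = !i) ∨
      Wit E i (!p) (L2Structure.above X x') := by
  have hX' := hX.above x'
  obtain ⟨x₀, y, z, u, w, ⟨hx₀, hmin₀, hy, hyz, hz, ha, hp⟩, hc⟩ := (hE.wit_iff hX).1 h
  obtain rfl : x₀ = x := le_antisymm (not_lt.1 fun h => hmin₀ _ h hx) (hmin _ hx₀)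
  have hx' : x' ∈ L2Structure.above X x' := mem_above.2 ⟨hxx'.1, le_rfl⟩
  rcases (hmin y hy).eq_or_lt with rfl | hlt
  · obtain rfl := hyz.unique hxx'
    refine .inl ⟨hp.1 Iff.rfl, fun j q h' => ?_⟩
    obtain ⟨x₁, y', z', u', w', ⟨hx₁, hmin₁, hy', -⟩, hc'⟩ := (hE.wit_iff hX').1 h'
    have := hc' z (mem_above.1 hy').2 hx'
    exact hE.col_unique hX' hx' this ((hE.above _ _ _ _ hX hyz.1 le_rfl).2 hz)
  · have hy' := hxx'.le_of_lt hy hlt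
    refine .inr ((hE.wit_iff hX').2 ⟨x', y, z, u, w, ⟨hx', fun a ha ha' =>
      (mem_above.1 ha').2.not_gt ha, mem_above.2 ⟨hy, hy'⟩, (isNext_above hy').2 hyz,
      (hE.above _ _ _ _ hX hyz.1 (hy'.trans hyz.2.1.le)).2 hz, fun s hs t ht hsX hst => ?_, ?_⟩,
      fun s hs hsX => ?_⟩)
    · obtain ⟨hsX, hs'⟩ := mem_above.1 hsX
      exact ha s hs t ht hsX ((isNext_above hs').1 hst)
    · have := ha x₀ hlt.le x' hy' hx hxx'
      rw [Bool.not_eq_true', ← Bool.not_eq_true, ← hp]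
      tauto
    · obtain ⟨hsX, hs'⟩ := mem_above.1 hsX
      exact (hE.above _ _ _ _ hX hsX hs').2 (hc s hs hsX)

/-- If `𝟑` is `Δ⁰₂`-BQO, then every two-colouring admits a homogeneous set. -/
theorem exists_homogeneous (h3 : IsDelta02BQO M.three) :
    ∃ X, M.IsInfinite X ∧ ∃ i, ∀ x ∈ X, Col E i x X := by
  by_contra! H
  -- Odd distance gives `0`; for even distance, the value `1` or `1 + 1` records the colour.
  let val : Bool → Bool → M.Num := fun i p => if p then (if i then 1 else 1 + 1) else 0
  have h01 : (0 : M.Num) ≠ 1 := zero_ne_one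
  have h12 : (1 : M.Num) ≠ 1 + 1 := (lt_add_one_iff.2 le_rfl).ne
  have h02 : (0 : M.Num) ≠ 1 + 1 := (lt_add_one_iff.2 zero_le).ne
  have hval : ∀ {i p j q}, val i p = val j q → p = q ∧ (p = true → i = j) := by
    intro i p j q
    cases i <;> cases p <;> cases j <;> cases q <;>
      simp [val, h01, h12, h02, h01.symm, h12.symm, h02.symm]
  let G : M.Num → M.Sets → Prop := fun q X => ∃ i p, q = val i p ∧ Wit E i p X
  have hG : IsS2 (fun (v : Fin 1 → M.Num) X => G (v 0) X) := by
    have := fun i p {m : ℕ} => hE.isS2_wit (n := m) i p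
    simp only [G, Bool.exists_bool]
    infer_instance
  obtain ⟨φ, hφ, hφ'⟩ := hG.exists_formula
  obtain ⟨A, hA⟩ := M.sets_nonempty
  have hdef : ∀ X q, DefRel φ (fun _ => 0) (fun _ => ⟨A, hA⟩) X q ↔ G q X := fun X q => by
    simp [DefRel, hφ']
  refine h3 φ hφ (fun _ => 0) (fun _ => ⟨A, hA⟩) (fun X hX => ?_) ?_
  · obtain ⟨i, p, hip⟩ := hE.wit_exists hX (H X hX)
    refine ⟨val i p, ?_, fun q => (hdef X q).trans ⟨?_, ?_⟩⟩
    · cases i <;> cases p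
      exacts [.inl rfl, .inr (.inr rfl), .inl rfl, .inr (.inl rfl)]
    · rintro ⟨j, q, rfl, h⟩
      obtain ⟨rfl, rfl⟩ := hE.wit_unique hX h hip
      rfl
    · rintro rfl
      exact ⟨i, p, rfl, hip⟩
  · rintro ⟨X, Y, hX, hXY, p, q, hp, hq, -, rfl⟩
    obtain ⟨x, hx, hmin⟩ := hX.exists_min
    obtain ⟨x', hx'⟩ := hX.exists_next x
    obtain rfl := (isTail_iff hx hmin hx').1 hXY
    obtain ⟨i, p, rfl, h⟩ := (hdef _ _).1 hp
    obtain ⟨j, q, hv, h'⟩ := (hdef _ _).1 hq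
    obtain ⟨rfl, hij⟩ := hval hv
    rcases hE.wit_tail hX hx hmin hx' h with ⟨rfl, h1⟩ | h1
    · have := h1 _ _ h'
      rw [← hij rfl] at this
      simp at this
    · have := (hE.wit_unique (hX.above x') h' h1).2
      simp at this

end IsColouring

end model
end L2Structure

namespace L2Structure

variable {M : L2Structure.{u}} {n : ℕ}

/-- Arithmetical comprehension, in the form of comprehension for `Σ⁰₁`-properties. -/
def ArithComprehension (M : L2Structure.{u}) : Prop :=
  ∀ P : M.Num → Prop, IsS1 (fun (v : Fin 1 → M.Num) (_ : M.Sets) => P (v 0)) →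
    ∃ S : M.Sets, ∀ a, a ∈ S ↔ P a

section model

variable [hM : Fact M.IsModelRCA0]

/-! ### Arithmetical comprehension from colourings -/

/-- `En` enumerates a set of numbers in stages: `En k s` says that `k` is enumerated at stage
`s`. -/
structure IsEnumeration (En : M.Num → M.Num → Prop) : Prop where
  isD0 : IsD0 (fun (v : Fin 2 → M.Num) (_ : M.Sets) => En (v 0) (v 1))
  le : ∀ k s, En k s → k ≤ s
  elem_unique : ∀ k l s, En k s → En l s → k = l
  stage_unique : ∀ k s t, En k s → En k t → s = t

/-- At stage `s` a number is enumerated that is smaller than all numbers enumerated later, but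
before stage `b`. -/
def TrueBelow (En : M.Num → M.Num → Prop) (s b : M.Num) : Prop :=
  ∃ k, k ≤ s ∧ En k s ∧ ∀ t, t < b → s < t → ∀ j, j < k → ¬ En j t

/-- `s` is a true stage, at which `k` is enumerated. -/
def TrueStage (En : M.Num → M.Num → Prop) (k s : M.Num) : Prop :=
  En k s ∧ ∀ t, s < t → ∀ j < k, ¬ En j t

/-- The colour of `X` at `x` indicates whether there is no true stage between `x` and the next
element of `X`. -/
def stageColouring (En : M.Num → M.Num → Prop) (i : Bool) (x m : M.Num) (X : M.Sets) : Prop :=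
  -- For colour `true`, `m` bounds a search that refutes every stage from `x` up to a later element
  -- `y` of `X`. For colour `false`, `m` is itself a true stage before the next element.
  if i then ∃ y, y ≤ m ∧ y ∈ X ∧ x < y ∧ ∀ s, s < y → x ≤ s → ¬ TrueBelow En s m
  else x ≤ m ∧ (∀ y, y ≤ m → y ∈ X → y ≤ x) ∧ ∀ b, TrueBelow En m b

namespace IsEnumeration

variable {En : M.Num → M.Num → Prop} (hEn : IsEnumeration En)
include hEn

omit hM in
theorem isD0' {m : ℕ} (f g : (Fin m → M.Num) → M.Num) [IsTm f] [IsTm g] :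
    IsD0 (fun v (_ : M.Sets) => En (f v) (g v)) :=
  hEn.isD0.comp ![f, g] (fun i => by fin_cases i <;> simpa)

theorem trueBelow_all {s : M.Num} : (∀ b, TrueBelow En s b) ↔ ∃ k, TrueStage En k s := by
  constructor
  · intro h
    obtain ⟨k, -, hk, -⟩ := h 0
    refine ⟨k, hk, fun t hst j hj hjt => ?_⟩
    obtain ⟨l, -, hl, h'⟩ := h (t + 1)
    obtain rfl := hEn.elem_unique _ _ _ hk hl
    exact h' t (lt_add_one_iff.2 le_rfl) hst j hj hjt
  · rintro ⟨k, hk, h⟩ b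
    exact ⟨k, hEn.le _ _ hk, hk, fun t _ hst => h t hst⟩

theorem trueStage_later {k s j t : M.Num} (h : TrueStage En k s) (hj : j ≤ k) (ht : s < t) :
    ¬ En j t := by
  rcases hj.lt_or_eq with hj | rfl
  · exact h.2 t ht j hj
  · exact fun h' => ht.ne (hEn.stage_unique _ _ _ h.1 h')

/-- A true stage `s₀` decides all earlier stages: if `k` survives up to `s₀`, then `k ≤ l`, and
after `s₀` nothing below `l` appears. -/
theorem trueBelow_iff {s l s₀ : M.Num} (h₀ : TrueStage En l s₀) (hs : s < s₀) :
    TrueBelow En s (s₀ + 1) ↔ ∃ k, TrueStage En k s := by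
  refine ⟨?_, fun h => hEn.trueBelow_all.2 h _⟩
  rintro ⟨k, hks, hk, h⟩
  refine ⟨k, hk, fun t hst j hj hjt => ?_⟩
  by_cases ht : t < s₀ + 1
  · exact h t ht hst j hj hjt
  · have ht' : s₀ < t := not_le.1 fun h => ht (lt_add_one_iff.2 h)
    have hl : ¬ l < k := fun hl => h s₀ (lt_add_one_iff.2 le_rfl) hs l hl h₀.1
    exact h₀.2 t ht' j (hj.trans_le (not_lt.1 hl)) hjt

/-- The least number enumerated from stage `b` on is enumerated at a true stage. If nothing is
enumerated from `b` on, the range is a set by bounded comprehension. -/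
theorem exists_trueStage (hno : ¬ ∃ S : M.Sets, ∀ k, k ∈ S ↔ ∃ s, En k s) (b : M.Num) :
    ∃ s, b ≤ s ∧ ∃ k, TrueStage En k s := by
  have hD := fun {m : ℕ} (f g : (Fin m → M.Num) → M.Num) [IsTm f] [IsTm g] => hEn.isD0' f g
  by_cases h : ∃ k s, b ≤ s ∧ En k s
  · obtain ⟨k, ⟨s, hs, hk⟩, hmin⟩ := exists_least_S1 (fun k => ∃ s, b ≤ s ∧ En k s) inferInstance h
    exact ⟨s, hs, k, hk, fun t hst j hj hjt => hmin j hj ⟨t, hs.trans hst.le, hjt⟩⟩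
  · push Not at h
    refine (hno ?_).elim
    obtain ⟨S, hS⟩ := comprehension_D0 (fun k => ∃ s < b, En k s) inferInstance
    refine ⟨S, fun k => (hS k).trans ⟨fun ⟨s, _, hs⟩ => ⟨s, hs⟩, fun ⟨s, hs⟩ => ⟨s, ?_, hs⟩⟩⟩
    exact not_le.1 fun hb => h k s hb hs

theorem isColouring (hno : ¬ ∃ S : M.Sets, ∀ k, k ∈ S ↔ ∃ s, En k s) :
    IsColouring (stageColouring En) where
  isP1 i := by
    have hD := fun {m : ℕ} (f g : (Fin m → M.Num) → M.Num) [IsTm f] [IsTm g] => hEn.isD0' f g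
    cases i
    · simp only [stageColouring, TrueBelow, Bool.false_eq_true, if_false]
      infer_instance
    · simp only [stageColouring, TrueBelow, if_true]
      infer_instance
  above i X a x _ _ ha := by
    refine exists_congr fun m => ?_
    cases i
    · simp only [stageColouring, Bool.false_eq_true, if_false, mem_above]
      refine and_congr_right fun _ => and_congr_left fun _ => forall₂_congr fun y _ => ?_
      exact ⟨fun h hy => not_lt.1 fun hxy => (h ⟨hy, ha.trans hxy.le⟩).not_gt hxy,
        fun h hy => h hy.1⟩
    · simp only [stageColouring, if_true, mem_above]
      refine exists_congr fun y => and_congr_right fun _ => ?_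
      exact ⟨fun h => ⟨h.1.1, h.2⟩, fun h => ⟨⟨h.1, ha.trans h.2.1.le⟩, h.2⟩⟩
  bound X hX c := by
    obtain ⟨x₀, hx₀, hx₀X⟩ := hX c
    replace hx₀ : c < x₀ := hx₀
    obtain ⟨s₀, hs₀, l, hl⟩ := hEn.exists_trueStage hno x₀
    -- Colour `false` is witnessed by a true stage before `y ≤ s₀`, colour `true` by `s₀ + 1`, where
    -- all stages before `s₀` are decided.
    refine ⟨s₀ + 1 + 1, fun x hx hxX => ?_⟩
    obtain ⟨y, hy⟩ := hX.exists_next x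
    have hys : y ≤ s₀ := (hy.le_of_lt hx₀X (hx.trans hx₀)).trans hs₀
    by_cases h : ∃ s, x ≤ s ∧ s < y ∧ ∃ k, TrueStage En k s
    · obtain ⟨s, hxs, hsy, hs⟩ := h
      refine ⟨false, s, ?_, ?_⟩
      · exact (hsy.trans_le hys).trans (lt_add_one_iff.2 (lt_add_one_iff.2 le_rfl).le)
      · simp only [stageColouring, Bool.false_eq_true, if_false]
        exact ⟨hxs, fun z hz hzX => hy.2.2 z (hz.trans_lt hsy) hzX, hEn.trueBelow_all.2 hs⟩
    · refine ⟨true, s₀ + 1, lt_add_one_iff.2 le_rfl, ?_⟩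
      simp only [stageColouring, if_true]
      refine ⟨y, hys.trans (lt_add_one_iff.2 le_rfl).le, hy.1, hy.2.1, fun s hsy hxs hs => h ?_⟩
      exact ⟨s, hxs, hsy, (hEn.trueBelow_iff hl (hsy.trans_le hys)).1 hs⟩
  excl X _ x _ i := by
    suffices H : Col (stageColouring En) true x X → ¬ Col (stageColouring En) false x X by
      cases i
      · exact fun h h' => H h' h
      · exact H
    rintro ⟨m, hm⟩ ⟨s, hs⟩
    simp only [stageColouring, if_true] at hm
    simp only [stageColouring, Bool.false_eq_true, if_false] at hs
    obtain ⟨y, -, hyX, hxy, h⟩ := hm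
    obtain ⟨hxs, hs', hT⟩ := hs
    exact h s (not_le.1 fun hys => (hs' y hys hyX).not_gt hxy) hxs (hT m)

/-- If all intervals between consecutive elements of `X` contain true stages, one can compute a
point after which `k` is no longer enumerated, so that the range is `Δ⁰₁`. The other colour would
exclude true stages beyond the minimum of `X`. -/
theorem exists_range (h3 : IsDelta02BQO M.three) : ∃ S : M.Sets, ∀ k, k ∈ S ↔ ∃ s, En k s := by
  by_contra hno
  have hD := fun {m : ℕ} (f g : (Fin m → M.Num) → M.Num) [IsTm f] [IsTm g] => hEn.isD0' f g
  obtain ⟨X, hX, i, hhom⟩ := (hEn.isColouring hno).exists_homogeneous h3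
  cases i
  · have htrue : ∀ x ∈ X, ∃ s, x ≤ s ∧ (∀ y ∈ X, x < y → s < y) ∧ ∃ k, TrueStage En k s := by
      intro x hx
      obtain ⟨s, hs⟩ := hhom x hx
      simp only [stageColouring, Bool.false_eq_true, if_false] at hs
      exact ⟨s, hs.1, fun y hy hxy => not_le.1 fun h => (hs.2.1 y h hy).not_gt hxy,
        hEn.trueBelow_all.1 hs.2.2⟩
    -- In an interval where nothing up to `k` is enumerated, the true stage enumerates some `l > k`.
    -- Nothing up to `l` appears later, which gives an interval for `k + 1`.
    have hB : ∀ k, ∃ x x', x ∈ X ∧ x' ∈ X ∧ x < x' ∧ ∀ s < x', x ≤ s → ∀ j ≤ k, ¬ En j s := by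
      have hstep : ∀ x ∈ X, ∃ x₁ x₂, IsNext X x x₁ ∧ IsNext X x₁ x₂ ∧ ∃ s, x ≤ s ∧ s < x₁ ∧
          ∃ k, En k s ∧ ∀ t, x₁ ≤ t → ∀ j ≤ k, ¬ En j t := by
        intro x hx
        obtain ⟨x₁, h₁⟩ := hX.exists_next x
        obtain ⟨x₂, h₂⟩ := hX.exists_next x₁
        obtain ⟨s, hxs, hs, k, hk⟩ := htrue x hx
        have hs' := hs x₁ h₁.1 h₁.2.1
        exact ⟨x₁, x₂, h₁, h₂, s, hxs, hs', k, hk.1,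
          fun t ht j hj => hEn.trueStage_later hk hj (hs'.trans_le ht)⟩
      refine induction_S1 _ inferInstance ?_ ?_
      · obtain ⟨x, hx, _⟩ := hX.exists_min
        obtain ⟨x₁, x₂, h₁, h₂, s, hxs, hs, k, hk, h⟩ := hstep x hx
        exact ⟨x₁, x₂, h₁.1, h₂.1, h₂.2.1, fun t _ ht j hj => h t ht j (hj.trans zero_le)⟩
      · rintro k ⟨x, x', hx, hx', hlt, hno'⟩
        obtain ⟨x₁, x₂, h₁, h₂, s, hxs, hs, l, hl, h⟩ := hstep x hx
        have hkl : k < l := not_le.1 fun hlk =>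
          hno' s (hs.trans_le (h₁.le_of_lt hx' hlt)) hxs l hlk hl
        exact ⟨x₁, x₂, h₁.1, h₂.1, h₂.2.1,
          fun t _ ht j hj => h t ht j (hj.trans (add_one_le_iff.2 hkl))⟩
    refine hno (comprehension (fun k => ∃ s, En k s) inferInstance ⟨?_⟩)
    -- Once an interval without numbers up to `v 0` is found, its true stage excludes `v 0` from
    -- then on, so only stages before `x'` remain to be checked.
    refine IsS1.congr (P := fun (v : Fin 1 → M.Num) _ => ∃ x x', x ∈ X ∧ x' ∈ X ∧ x < x' ∧
      (∀ s < x', x ≤ s → ∀ j ≤ v 0, ¬ En j s) ∧ ∀ s < x', ¬ En (v 0) s) inferInstance fun v _ => ?_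
    constructor
    · intro h
      obtain ⟨x, x', hx, hx', hlt, h'⟩ := hB (v 0)
      exact ⟨x, x', hx, hx', hlt, h', fun s _ hs => h ⟨s, hs⟩⟩
    · rintro ⟨x, x', hx, hx', hlt, h', h''⟩ ⟨t, ht⟩
      obtain ⟨s, hxs, hs, k, hk⟩ := htrue x hx
      have hsx' := hs x' hx' hlt
      have hkv : v 0 < k := not_le.1 fun hle => h' s hsx' hxs k hle hk.1
      have hx't : x' ≤ t := not_lt.1 fun h => h'' t h ht
      exact hEn.trueStage_later hk hkv.le (hsx'.trans_le hx't) ht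
  · obtain ⟨x, hx, _⟩ := hX.exists_min
    obtain ⟨s, hxs, hs⟩ := hEn.exists_trueStage hno x
    obtain ⟨y, hys, hy, hmax⟩ := exists_greatest (fun t => t ∈ X) inferInstance ⟨x, hxs, hx⟩
    obtain ⟨m, hm⟩ := hhom y hy
    simp only [stageColouring, if_true] at hm
    obtain ⟨y', -, hy', hyy', h⟩ := hm
    have hsy' : s < y' := not_le.1 fun h => (hmax y' h hy').not_gt hyy'
    exact h s hsy' hys (hEn.trueBelow_all.2 hs m)

end IsEnumeration

theorem arithComprehension_of_three (h3 : IsDelta02BQO M.three) : ArithComprehension M := by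
  intro P hP
  obtain ⟨Q, hQ, hPQ⟩ := hP
  obtain ⟨A, hA⟩ := M.sets_nonempty
  let R : M.Num → M.Num → Prop := fun m k => Q m (fun _ => k) ⟨A, hA⟩
  have hR : ∀ {m : ℕ} (f g : (Fin m → M.Num) → M.Num) [IsTm f] [IsTm g],
      IsD0 (fun v (_ : M.Sets) => R (f v) (g v)) := fun f g _ _ =>
    (hQ.comp_param ![g, f] (fun i => by fin_cases i <;> simpa) ⟨A, hA⟩).congr fun v _ =>
      iff_of_eq (congrArg (fun z => Q (f v) z ⟨A, hA⟩) (funext fun i => by fin_cases i; rfl))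
  have hPR : ∀ k, P k ↔ ∃ m, R m k := fun k => hPQ (fun _ => k) ⟨A, hA⟩
  -- The stage is the code of `k` with its least witness, so stages and enumerated numbers determine
  -- each other.
  let En : M.Num → M.Num → Prop := fun k s => ∃ m ≤ s, s = M.pair k m ∧ R m k ∧ ∀ l < m, ¬ R l k
  have hEn : IsEnumeration En := by
    refine ⟨inferInstanceAs (IsD0 fun (v : Fin 2 → M.Num) (_ : M.Sets) =>
      ∃ m ≤ v 1, v 1 = M.pair (v 0) m ∧ R m (v 0) ∧ ∀ l < m, ¬ R l (v 0)), ?_, ?_, ?_⟩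
    · rintro k s ⟨m, _, rfl, _⟩
      exact left_le_pair _ _
    · rintro k l s ⟨m, _, rfl, _⟩ ⟨m', _, h, _⟩
      exact (pair_inj.1 h).1
    · rintro k s t ⟨m, _, rfl, h1, h2⟩ ⟨m', _, rfl, h1', h2'⟩
      rw [le_antisymm (not_lt.1 fun h => h2 _ h h1') (not_lt.1 fun h => h2' _ h h1)]
  obtain ⟨S, hS⟩ := hEn.exists_range h3
  refine ⟨S, fun k => (hS k).trans ((hPR k).trans ?_).symm⟩
  constructor
  · intro h
    obtain ⟨m, hm, hmin⟩ := exists_least (fun m => R m k) inferInstance h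
    exact ⟨M.pair k m, m, right_le_pair _ _, rfl, hm, hmin⟩
  · rintro ⟨s, m, _, _, h, _⟩
    exact ⟨m, h⟩

/-- Two applications of `Σ⁰₁`-comprehension: one for the complement `N` of the `Π⁰₁`-matrix, one for
the outer quantifier relative to `N`. -/
theorem ArithComprehension.comprehension_S2 (aca : ArithComprehension M) (P : M.Num → Prop)
    (hP : IsS2 (fun (v : Fin 1 → M.Num) (_ : M.Sets) => P (v 0))) :
    ∃ S : M.Sets, ∀ a, a ∈ S ↔ P a := by
  obtain ⟨Q, hQ, hPQ⟩ := hP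
  obtain ⟨A, hA⟩ := M.sets_nonempty
  let R : M.Num → M.Num → Prop := fun m k => Q m (fun _ => k) ⟨A, hA⟩
  have hR : ∀ {m : ℕ} (f g : (Fin m → M.Num) → M.Num) [IsTm f] [IsTm g],
      IsP1 (fun v (_ : M.Sets) => R (f v) (g v)) := fun f g _ _ =>
    (hQ.subst ![g, f] (fun i => by fin_cases i <;> simpa) (fun _ _ => ⟨A, hA⟩)
      fun _ _ _ _ => inferInstance).congr fun v _ =>
        iff_of_eq (congrArg (fun z => Q (f v) z ⟨A, hA⟩) (funext fun i => by fin_cases i; rfl))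
  obtain ⟨N, hN⟩ := aca (fun c => ∃ m ≤ c, ∃ k ≤ c, c = M.pair m k ∧ ¬ R m k) inferInstance
  obtain ⟨S, hS⟩ := aca (fun k => ∃ m, ¬ M.pair m k ∈ N) inferInstance
  refine ⟨S, fun k => (hS k).trans ((exists_congr fun m => ?_).trans
    (hPQ (fun _ => k) ⟨A, hA⟩).symm)⟩
  rw [hN, not_iff_comm]
  constructor
  · exact fun h => ⟨m, left_le_pair _ _, k, right_le_pair _ _, rfl, h⟩
  · rintro ⟨m', _, k', _, heq, h⟩
    obtain ⟨rfl, rfl⟩ := pair_inj.1 heq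
    exact h

theorem ArithComprehension.comprehension_pair (aca : ArithComprehension M)
    (P : M.Num → M.Num → Prop)
    (hP : IsS2 (fun (v : Fin 2 → M.Num) (_ : M.Sets) => P (v 0) (v 1))) :
    ∃ S : M.Sets, ∀ a b, M.pair a b ∈ S ↔ P a b := by
  have hP' : ∀ {m : ℕ} (f g : (Fin m → M.Num) → M.Num) [IsTm f] [IsTm g],
      IsS2 (fun v (_ : M.Sets) => P (f v) (g v)) := fun f g _ _ =>
    hP.subst ![f, g] (fun i => by fin_cases i <;> simpa) (fun _ X => X)
      fun _ _ _ _ => inferInstance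
  obtain ⟨S, hS⟩ := aca.comprehension_S2 (fun c => ∃ a ≤ c, ∃ b ≤ c, c = M.pair a b ∧ P a b)
    inferInstance
  refine ⟨S, fun a b => (hS _).trans ⟨?_, fun h =>
    ⟨a, left_le_pair _ _, b, right_le_pair _ _, rfl, h⟩⟩⟩
  rintro ⟨a', _, b', _, heq, h⟩
  obtain ⟨rfl, rfl⟩ := pair_inj.1 heq
  exact h

theorem IsWellOrder.no_descent_S2 {D R : M.Sets} (hΩ : M.IsWellOrder D R)
    (aca : ArithComprehension M) (Z : M.Num → M.Num → Prop)
    (hZ : IsS2 (fun (v : Fin 2 → M.Num) (_ : M.Sets) => Z (v 0) (v 1)))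
    (hfun : ∀ k, ∃! a, Z k a)
    (hdesc : ∀ k a b, Z k a → Z (k + 1) b → a ∈ D ∧ b ∈ D ∧ M.pair b a ∈ R ∧ b ≠ a) : False := by
  obtain ⟨S, hS⟩ := aca.comprehension_pair Z hZ
  refine hΩ.no_descent ⟨S, fun k => ?_, fun k a b ha hb =>
    hdesc k a b ((hS _ _).1 ha) ((hS _ _).1 hb)⟩
  obtain ⟨a, ha, huniq⟩ := hfun k
  exact ⟨a, (hS _ _).2 ha, fun b hb => huniq b ((hS _ _).1 hb)⟩

end model
end L2Structure

namespace L2Structure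

variable {M : L2Structure.{u}}

section model

variable [hM : Fact M.IsModelRCA0]

/-! ### Products of well orders -/

/-- `F(X) = ⟨a, b⟩` for the coordinates `a` and `b`, which are swapped if `i` is false. -/
def CoordRel (F : M.Num → M.Sets → Prop) (i : Bool) (a b : M.Num) (X : M.Sets) : Prop :=
  if i then F (M.pair a b) X else F (M.pair b a) X

/-- The coordinate with index `i` descends between `X` at `x` and its tail, and the first coordinate
does not descend if `i` is false. -/
def DescentRel (F : M.Num → M.Sets → Prop) (R : M.Sets) (i : Bool) (x : M.Num) (X : M.Sets) :
    Prop :=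
  ∃ y a b c d, IsNext X x y ∧ CoordRel F i a b (above X x) ∧ CoordRel F i c d (above X y) ∧
    M.pair c a ∈ R ∧ ¬ c = a ∧ (¬ i = true → M.pair b d ∈ R)

section

variable {D R : M.Sets} (hΩ : M.IsWellOrder D R) {F : M.Num → M.Sets → Prop}
  (hF : IsS2 (fun (v : Fin 1 → M.Num) X => F (v 0) X))
  (hdef : ∀ X, M.IsInfinite X → ∃ q,
    (prod (M.codedOrder D R) (M.codedOrder D R)).carrier q ∧ ∀ p, F p X ↔ p = q)

include hF in
theorem isS2_coordRel (i : Bool) {m : ℕ} (f g h : (Fin m → M.Num) → M.Num) [IsTm f] [IsTm g]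
    [hh : IsTm h] : IsS2 (fun v X => CoordRel F i (f v) (g v) (above X (h v))) := by
  have key : ∀ (k : (Fin m → M.Num) → M.Num) [IsTm k],
      IsS2 (fun v X => F (k v) (above X (h v))) := fun k _ => by
    refine hF.subst ![k] (fun i => by fin_cases i; simpa) (fun v X => above X (h v))
      fun {m'} τ ρ hτ hρ => ?_
    have : IsTm fun v => h (ρ v) := by
      obtain ⟨t, ht, ht'⟩ := hh
      have := t.val_isTm (fun i v => if hi : i < m then ρ v ⟨i, hi⟩ else 0) (fun i => by
        by_cases hi : i < m
        · simp only [hi, dif_pos]; exact hρ _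
        · simp only [hi, dif_neg, not_false_eq_true]; infer_instance)
      simpa [ht'] using this
    simp only [mem_above]
    infer_instance
  cases i
  · exact key _
  · exact key _

include hF in
theorem isS2_coordRel_param (i : Bool) {m : ℕ} (f g h : (Fin m → M.Num) → M.Num) [IsTm f] [IsTm g]
    [hh : IsTm h] (X : M.Sets) :
    IsS2 (fun v (_ : M.Sets) => CoordRel F i (f v) (g v) (above X (h v))) :=
  (isS2_coordRel hF i (fun v : Fin 3 → M.Num => v 0) (fun v => v 1) (fun v => v 2)).subst ![f, g, h]
    (fun i => by fin_cases i <;> simpa) (fun _ _ => X) fun _ _ _ _ => inferInstance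

include hF in
theorem isS2_descentRel (i : Bool) :
    IsS2 (fun (v : Fin 1 → M.Num) X => DescentRel F R i (v 0) X) := by
  have := fun {m : ℕ} (f g h : (Fin m → M.Num) → M.Num) [IsTm f] [IsTm g] [IsTm h] =>
    isS2_coordRel hF i f g h
  cases i
  · simp only [DescentRel, Bool.false_eq_true, not_false_eq_true, true_imp_iff]
    infer_instance
  · simp only [DescentRel, not_true, false_imp_iff, and_true]
    infer_instance

include hdef in
theorem exists_coordRel (i : Bool) {X : M.Sets} (hX : M.IsInfinite X) :
    ∃ a b, a ∈ D ∧ b ∈ D ∧ CoordRel F i a b X ∧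
      ∀ c d, CoordRel F i c d X → c = a ∧ d = b := by
  obtain ⟨q, ⟨a, b, ha, hb, rfl⟩, h⟩ := hdef X hX
  cases i
  · exact ⟨b, a, hb, ha, (h _).2 rfl, fun c d hcd => (pair_inj.1 ((h _).1 hcd)).symm⟩
  · exact ⟨a, b, ha, hb, (h _).2 rfl, fun c d hcd => pair_inj.1 ((h _).1 hcd)⟩

include hΩ hdef in
theorem descentRel_excl {X : M.Sets} (hX : M.IsInfinite X) {x : M.Num}
    (h : DescentRel F R true x X) : ¬ DescentRel F R false x X := by
  rintro ⟨y', a', b', c', d', hy', h1', h2', -, -, h5'⟩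
  obtain ⟨y, a, b, c, d, hy, h1, h2, h3, h4, -⟩ := h
  obtain rfl := hy.unique hy'
  obtain ⟨p, q, hp, -, -, hpq⟩ := exists_coordRel hdef true (hX.above x)
  obtain ⟨p', q', hp', -, -, hpq'⟩ := exists_coordRel hdef true (hX.above y)
  obtain ⟨rfl, rfl⟩ := hpq _ _ h1
  obtain ⟨rfl, rfl⟩ := hpq' _ _ h2
  obtain ⟨rfl, rfl⟩ := hpq _ _ h1'
  obtain ⟨rfl, rfl⟩ := hpq' _ _ h2'
  -- The first coordinate cannot both descend strictly and not descend.
  exact h4 (hΩ.antisymm _ _ hp' hp h3 (h5' (by simp)))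

include hΩ hdef in
-- If the first coordinate does not descend, badness and linearity force the second to descend
-- strictly.
theorem descentRel_total
    (hbad : ∀ X x y, M.IsInfinite X → x ∈ X → IsNext X x y → ∀ a b c d, a ∈ D → b ∈ D → c ∈ D →
      d ∈ D → F (M.pair a b) (above X x) → F (M.pair c d) (above X y) → M.pair a c ∈ R →
      ¬ M.pair b d ∈ R)
    {X : M.Sets} (hX : M.IsInfinite X) {x : M.Num} (hx : x ∈ X) : ∃ i, DescentRel F R i x X := by
  obtain ⟨y, hy⟩ := hX.exists_next x
  obtain ⟨a, b, ha, hb, hab, -⟩ := exists_coordRel hdef true (hX.above x)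
  obtain ⟨c, d, hc, hd, hcd, -⟩ := exists_coordRel hdef true (hX.above y)
  by_cases h : M.pair a c ∈ R
  · have h' := hbad X x y hX hx hy a b c d ha hb hc hd hab hcd h
    refine ⟨false, y, b, a, d, c, hy, hab, hcd, (hΩ.total b d hb hd).resolve_left h', ?_,
      fun _ => h⟩
    rintro rfl
    exact h' (hΩ.refl d hd)
  · refine ⟨true, y, a, b, c, d, hy, hab, hcd, (hΩ.total a c ha hc).resolve_left h, ?_, by simp⟩
    rintro rfl
    exact h (hΩ.refl c hc)

include hΩ hF hdef in
-- Along the increasing enumeration `e` of `X`, the coordinate with index `i` would form a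
-- descending sequence with `Σ⁰₂`-graph, which is a set by arithmetical comprehension.
theorem descentRel_not_homogeneous (aca : ArithComprehension M) {X : M.Sets}
    (hX : M.IsInfinite X) (i : Bool) : ¬ ∀ x ∈ X, DescentRel F R i x X := by
  intro h
  obtain ⟨e, S, hS, heX, he⟩ := hX.exists_enum
  have := fun {m : ℕ} (f g h : (Fin m → M.Num) → M.Num) [IsTm f] [IsTm g] [IsTm h] =>
    isS2_coordRel_param hF i f g h X
  have hZ : ∀ k a, (∃ x b, M.pair k x ∈ S ∧ CoordRel F i a b (above X x)) ↔
      ∃ b, CoordRel F i a b (above X (e k)) := fun k a => by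
    simp only [hS, exists_and_left, exists_eq_left']
  refine hΩ.no_descent_S2 aca (fun k a => ∃ x b, M.pair k x ∈ S ∧ CoordRel F i a b (above X x))
    inferInstance (fun k => ?_) fun k a c ha hc => ?_
  · simp only [hZ]
    obtain ⟨a, b, -, -, hab, huniq⟩ := exists_coordRel hdef i (hX.above (e k))
    exact ⟨a, ⟨b, hab⟩, fun c ⟨d, hcd⟩ => (huniq c d hcd).1⟩
  · obtain ⟨b, hab⟩ := (hZ _ _).1 ha
    obtain ⟨d, hcd⟩ := (hZ _ _).1 hc
    obtain ⟨y, a', b', c', d', hy, h1, h2, h3, h4, -⟩ := h (e k) (heX k)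
    obtain rfl := hy.unique (he k)
    obtain ⟨p, q, hp, -, -, hpq⟩ := exists_coordRel hdef i (hX.above (e k))
    obtain ⟨p', q', hp', -, -, hpq'⟩ := exists_coordRel hdef i (hX.above (e (k + 1)))
    obtain ⟨rfl, rfl⟩ := hpq _ _ hab
    obtain ⟨rfl, rfl⟩ := hpq' _ _ hcd
    obtain ⟨rfl, rfl⟩ := hpq _ _ h1
    obtain ⟨rfl, rfl⟩ := hpq' _ _ h2
    exact ⟨hp, hp', h3, h4⟩

end

/-- The only substantial point is the bound on witnesses: for fixed `X`, the witness relations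
become sets by arithmetical comprehension, and then bounded collection suffices. -/
theorem isColouring_of_isS2 (aca : ArithComprehension M) (C : Bool → M.Num → M.Sets → Prop)
    (hC : ∀ i, IsS2 (fun (v : Fin 1 → M.Num) X => C i (v 0) X))
    (habove : ∀ i X a x, M.IsInfinite X → x ∈ X → a ≤ x → (C i x (above X a) ↔ C i x X))
    (htotal : ∀ X, M.IsInfinite X → ∀ x ∈ X, ∃ i, C i x X)
    (hexcl : ∀ X, M.IsInfinite X → ∀ x ∈ X, C true x X → ¬ C false x X) :
    ∃ E, IsColouring E ∧ ∀ i x X, Col E i x X ↔ C i x X := by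
  choose Q hQ hCQ using fun i => (hC i).ex
  let E : Bool → M.Num → M.Num → M.Sets → Prop := fun i x m X => Q i m (fun _ => x) X
  have hCE : ∀ i x X, Col E i x X ↔ C i x X := fun i x X => (hCQ i (fun _ => x) X).symm
  have hE : ∀ i, IsP1 (fun (v : Fin 2 → M.Num) X => E i (v 0) (v 1) X) := fun i =>
    (hQ i).comp_snoc (fun v : Fin 2 → M.Num => v 1) inferInstance (fun _ v => v 0)
      fun _ => inferInstance
  refine ⟨E, ⟨hE, fun i X a x hX hx ha => ?_, fun X hX c => ?_, fun X hX x hx i => ?_⟩, hCE⟩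
  · rw [hCE, hCE, habove i X a x hX hx ha]
  · have hA : ∀ i, ∃ A : M.Sets, ∀ x m, M.pair x m ∈ A ↔ E i x m X := fun i =>
      aca.comprehension_pair (fun x m => E i x m X) (IsS2.of_isP1 _ (hP :=
        (hE i).subst (fun i v => v i) (fun _ => inferInstance) (fun _ _ => X)
          fun _ _ _ _ => inferInstance))
    choose A hA using hA
    obtain ⟨b, hb⟩ := collection_D0
      (fun x m => x ∈ X → (M.pair x m ∈ A true ∨ M.pair x m ∈ A false)) inferInstance c (by
        intro x _
        by_cases hx : x ∈ X
        · obtain ⟨i, hi⟩ := htotal X hX x hx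
          obtain ⟨m, hm⟩ := (hCE i x X).2 hi
          refine ⟨m, fun _ => ?_⟩
          cases i
          · exact .inr ((hA _ _ _).2 hm)
          · exact .inl ((hA _ _ _).2 hm)
        · exact ⟨0, fun h => (hx h).elim⟩)
    refine ⟨b, fun x hx hxX => ?_⟩
    obtain ⟨m, hm, h⟩ := hb x hx
    rcases h hxX with h | h
    · exact ⟨true, m, hm, (hA _ _ _).1 h⟩
    · exact ⟨false, m, hm, (hA _ _ _).1 h⟩
  · rw [hCE, hCE]
    cases i
    · exact fun h h' => hexcl X hX x hx h' h
    · exact hexcl X hX x hx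

end model
end L2Structure

theorem mainTheorem9 (M : L2Structure.{u}) (hM : M.IsModelRCA0)
    (h3 : L2Structure.IsDelta02BQO M.three)
    (D R : M.Sets) (hΩ : M.IsWellOrder D R) :
    L2Structure.IsDelta02BQO
      (L2Structure.prod (M.codedOrder D R) (M.codedOrder D R)) := by
  have : Fact M.IsModelRCA0 := ⟨hM⟩
  intro φ hφ v W hdef hbad
  -- Badness speaks of tails, while the colouring compares consecutive final segments of a fixed
  -- `X`.
  have htail : ∀ (X : M.Sets) (x y : M.Num), x ∈ X → L2Structure.IsNext X x y →
      M.IsTail (L2Structure.above X x) (L2Structure.above X y) := fun X x y hx hy => by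
    rw [← L2Structure.above_above hy.2.1.le]
    exact (L2Structure.isTail_iff (L2Structure.mem_above.2 ⟨hx, le_rfl⟩)
      (fun a ha => (L2Structure.mem_above.1 ha).2) ((L2Structure.isNext_above le_rfl).2 hy)).2 rfl
  have aca := L2Structure.arithComprehension_of_three h3
  have hF := hφ.isS2 v W
  obtain ⟨E, hE, hEC⟩ := L2Structure.isColouring_of_isS2 aca
    (L2Structure.DescentRel (fun q X => L2Structure.DefRel φ v W X q) R)
    (L2Structure.isS2_descentRel hF)
    (fun i X a x _ _ ha => by
      refine exists_congr fun y => ?_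
      simp only [L2Structure.isNext_above ha]
      refine exists_congr fun p => exists_congr fun q => exists_congr fun p' =>
        exists_congr fun q' => and_congr_right fun hy => ?_
      rw [L2Structure.above_above ha, L2Structure.above_above (ha.trans hy.2.1.le)])
    (fun X hX x hx => L2Structure.descentRel_total hΩ hdef
      (fun X x y hX hx hy a b c d ha hb hc hd h1 h2 h3 h4 => hbad
        ⟨L2Structure.above X x, L2Structure.above X y, hX.above x, htail X x y hx hy, _, _, h1, h2,
          a, b, c, d, rfl, rfl, ⟨ha, hc, h3⟩, ⟨hb, hd, h4⟩⟩) hX hx)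
    (fun X hX x _ => L2Structure.descentRel_excl hΩ hdef hX)
  obtain ⟨X, hX, i, h⟩ := hE.exists_homogeneous h3
  exact L2Structure.descentRel_not_homogeneous hΩ hF hdef aca hX i
    fun x hx => (hEC i x X).1 (h x hx)
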